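/- Let $N\ge 1$, let $\Omega\subset\mathbb{R}^N$ be a bounded open set, $T>0$, $Q=\Omega\times(0,T)$, $Y=(-\tfrac12,\tfrac12)^N$, $Z=(-\tfrac12,\tfrac12)$. Let $a_{ij}\in L^\infty(\mathbb{R}^N;\mathbb{R})$ ($1\le i,j\le N$) be $Y$-periodic with $a_{ij}=a_{ji}$ and, for some $\alpha>0$, $\sum_{i,j}a_{ij}(y)\zeta_j\zeta_i\ge\alpha|\zeta|^2$ for almost all $y$ and all $\zeta\in\mathbb{R}^N$. Let $V=\{\mathbf v\in H_0^1(\Omega;\mathbb{R})^N:\operatorname{div}\mathbf v=0\}$, let $V_Y$ be the space of $Y$-periodic $\mathbf w\in H^1_{loc}(\mathbb{R}^N;\mathbb{R})^N$ with $\int_Y\mathbf w\,dy=0$ and $\operatorname{div}_y\mathbf w=0$, and let $L^2_{per}(Z;V_Y)$ be the space of $Z$-periodic functions $\tau\mapsto \mathbf w(\cdot,\tau)\in V_Y$ that are square integrable over $Z$. Let $\mathbf f\in L^2(0,T;V')$, and let $\mathbf u=(\mathbf u_0,\mathbf u_1)$ be the solution of the two-scale homogenized problem: $\mathbf u_0\in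 L^2(0,T;V)$, $\mathbf u_0'\in L^2(0,T;V')$, $\mathbf u_0(0)=0$, $\mathbf u_1\in L^2(Q;L^2_{per}(Z;V_Y))$ and $$\int_0^T(\mathbf u_0',\mathbf v_0)\,dt+\sum_{i,j,k=1}^N\int_0^T\!\!\int_\Omega\iint_{Y\times Z}a_{ij}(y)\Big(\frac{\partial u_0^k}{\partial x_j}+\frac{\partial u_1^k}{\partial y_j}\Big)\Big(\frac{\partial v_0^k}{\partial x_i}+\frac{\partial v_1^k}{\partial y_i}\Big)dy\,d\tau\,dx\,dt=\int_0^T(\mathbf f,\mathbf v_0)\,dt$$ for all $(\mathbf v_0,\mathbf v_1)\in L^2(0,T;V)\times L^2(Q;L^2_{per}(Z;V_Y))$. Then for all $1\le i,k\le N$ the cell problem $$\boldsymbol\chi_{ik}\in L^2_{per}(Z;V_Y),\qquad \sum_{l,j,m=1}^N\iint_{Y\times Z}a_{lj}\frac{\partial\chi_{ik}^m}{\partial y_j}\frac{\partial w^m}{\partial y_l}\,dy\,d\tau=\sum_{l=1}^N\iint_{Y\times Z}a_{li}\frac{\partial w^k}{\partial y_l}\,dy\,d\tau\quad\text{for all }\mathbf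 w\in L^2_{per}(Z;V_Y)$$ has exactly one solution (up to equality almost everywhere), and $$\mathbf u_1(x,t,y,\tau)=-\sum_{i,k=1}^N\frac{\partial u_0^k}{\partial x_i}(x,t)\,\boldsymbol\chi_{ik}(y,\tau)\qquad\text{for almost every }(x,t,y,\tau)\in Q\times Y\times Z.$$ -/

import Mathlib

open MeasureTheory Set
open scoped ContDiff

noncomputable section

namespace StokesHomogenization

/-- The numerical space `ℝ^N` with its Euclidean norm. -/
abbrev Vec (N : ℕ) : Type := EuclideanSpace ℝ (Fin N)

/-- `N × N` matrices with the Frobenius norm.  For a vector field `u = (u^k)`, the entry `(k, j)`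
of its gradient is `∂u^k/∂x_j`. -/
abbrev Mat (N : ℕ) : Type := EuclideanSpace ℝ (Fin N × Fin N)

/-- The gradient matrix of a smooth vector field. -/
def gradMat {N : ℕ} (φ : Vec N → Vec N) (x : Vec N) : Mat N :=
  WithLp.toLp 2 fun p : Fin N × Fin N => fderiv ℝ φ x (EuclideanSpace.single p.2 1) p.1

/-! ### The space `V` of divergence-free fields in `H_0^1(Ω; ℝ)^N` -/

/-- Pairs (field, gradient) in `L²(Ω)^N × L²(Ω)^{N×N}`, with the Hilbert norm
`(‖u‖² + ‖Du‖²)^{1/2}`; the space `H^1(Ω)^N` sits in it through `u ↦ (u, Du)`. -/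
abbrev GraphSpace {N : ℕ} (Ω : Set (Vec N)) : Type :=
  WithLp 2 (Lp (Vec N) 2 (volume.restrict Ω) × Lp (Mat N) 2 (volume.restrict Ω))

/-- The pairs `(φ, Dφ)` with `φ ∈ 𝒟(Ω; ℝ)^N`. -/
def testPairs {N : ℕ} (Ω : Set (Vec N)) : Set (GraphSpace Ω) :=
  {p | ∃ φ : Vec N → Vec N, ContDiff ℝ ∞ φ ∧ HasCompactSupport φ ∧ tsupport φ ⊆ Ω ∧
    p.fst =ᵐ[volume.restrict Ω] φ ∧ p.snd =ᵐ[volume.restrict Ω] gradMat φ}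

/-- `H_0^1(Ω; ℝ)^N`: the closure of `𝒟(Ω; ℝ)^N` in the `H^1` norm (each field is carried along with
its weak gradient). -/
def H10 {N : ℕ} (Ω : Set (Vec N)) : Submodule ℝ (GraphSpace Ω) :=
  (Submodule.span ℝ (testPairs Ω)).topologicalClosure

/-- `V = {u ∈ H_0^1(Ω; ℝ)^N : div u = 0}`.  It carries the `H^1` norm, which on a bounded `Ω` is
equivalent to the gradient norm. -/
def V {N : ℕ} (Ω : Set (Vec N)) : Submodule ℝ (GraphSpace Ω) where
  carrier := {p | p ∈ H10 Ω ∧ ∀ᵐ x ∂volume.restrict Ω, ∑ k, p.snd x (k, k) = 0}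
  add_mem' := by
    rintro p q ⟨hp, hp'⟩ ⟨hq, hq'⟩
    refine ⟨add_mem hp hq, ?_⟩
    filter_upwards [hp', hq', Lp.coeFn_add p.snd q.snd] with x h1 h2 h3
    have h3' : (p + q).snd x = p.snd x + q.snd x := h3
    simp only [h3', PiLp.add_apply, Finset.sum_add_distrib, h1, h2, add_zero]
  zero_mem' := by
    refine ⟨zero_mem _, ?_⟩
    filter_upwards [Lp.coeFn_zero (Mat N) 2 (volume.restrict Ω)] with x h
    have h' : (0 : GraphSpace Ω).snd x = 0 := h
    simp only [h', PiLp.zero_apply, Finset.sum_const_zero]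
  smul_mem' := by
    rintro c p ⟨hp, hp'⟩
    refine ⟨Submodule.smul_mem _ c hp, ?_⟩
    filter_upwards [hp', Lp.coeFn_smul c p.snd] with x h1 h2
    have h2' : (c • p).snd x = c • p.snd x := h2
    simp only [h2', PiLp.smul_apply, smul_eq_mul, ← Finset.mul_sum, h1, mul_zero]

/-- The space-time cylinder `Q = Ω × ]0, T[`. -/
def cyl {N : ℕ} (Ω : Set (Vec N)) (T : ℝ) : Set (Vec N × ℝ) := Ω ×ˢ Ioo 0 T

/-- An element `v` of `L²(0, T; V)`, both as a function `v(x, t)` on `Q` (with its spatial gradient)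
and as the square integrable path `t ↦ v(t) ∈ V`. -/
structure L2V {N : ℕ} (Ω : Set (Vec N)) (T : ℝ) where
  toFun : Vec N × ℝ → Vec N
  grad : Vec N × ℝ → Mat N
  path : ℝ → V Ω
  memLp_toFun : MemLp toFun 2 (volume.restrict (cyl Ω T))
  memLp_grad : MemLp grad 2 (volume.restrict (cyl Ω T))
  memLp_path : MemLp path 2 (volume.restrict (Ioo 0 T))
  path_fst : ∀ᵐ t ∂volume.restrict (Ioo 0 T),
    (path t : GraphSpace Ω).fst =ᵐ[volume.restrict Ω] fun x => toFun (x, t)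
  path_snd : ∀ᵐ t ∂volume.restrict (Ioo 0 T),
    (path t : GraphSpace Ω).snd =ᵐ[volume.restrict Ω] fun x => grad (x, t)

/-- `u' = g` in the sense of `V'`-valued distributions on `]0, T[`, with `g ∈ L²(0, T; V')`, where
`L²` fields act on `V` by the `L²` inner product.  So `u ∈ 𝒲(0, T)` iff such a `g` exists. -/
def IsTimeDeriv {N : ℕ} {Ω : Set (Vec N)} {T : ℝ} (u : L2V Ω T)
    (g : ℝ → StrongDual ℝ (V Ω)) : Prop :=
  MemLp g 2 (volume.restrict (Ioo 0 T)) ∧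
  ∀ (v : V Ω) (φ : ℝ → ℝ), ContDiff ℝ ∞ φ → HasCompactSupport φ → tsupport φ ⊆ Ioo 0 T →
    ∫ t in Ioo 0 T, inner ℝ (u.path t : GraphSpace Ω).fst (v : GraphSpace Ω).fst * deriv φ t
      = - ∫ t in Ioo 0 T, g t v * φ t

/-- `u(0) = 0`: the representative of `u` in `𝒞([0, T]; L²(Ω)^N)` vanishes at `t = 0`. -/
def VanishesAtZero {N : ℕ} {Ω : Set (Vec N)} {T : ℝ} (u : L2V Ω T) : Prop :=
  ∃ U : ℝ → Lp (Vec N) 2 (volume.restrict Ω), ContinuousOn U (Icc 0 T) ∧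
    (∀ᵐ t ∂volume.restrict (Ioo 0 T), U t = (u.path t : GraphSpace Ω).fst) ∧ U 0 = 0

/-! ### Periodic spaces -/

/-- `Y = (-1/2, 1/2)^N`. -/
def cellY (N : ℕ) : Set (Vec N) := {y | ∀ i, y i ∈ Ioo (-(1 / 2) : ℝ) (1 / 2)}

/-- `Y × Z` with `Z = (-1/2, 1/2)`. -/
def cellYZ (N : ℕ) : Set (Vec N × ℝ) := cellY N ×ˢ Ioo (-(1 / 2) : ℝ) (1 / 2)

/-- The point of `ℝ^N` with the integer coordinates `m`. -/
def latticePt {N : ℕ} (m : Fin N → ℤ) : Vec N := WithLp.toLp 2 fun i => (m i : ℝ)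

/-- `Y`-periodicity of a class of functions on `ℝ^N`. -/
def IsYPeriodic {N : ℕ} {F : Type*} (w : Vec N → F) : Prop :=
  ∀ m : Fin N → ℤ, ∀ᵐ y, w (y + latticePt m) = w y

/-- `w ∈ V_Y`, with weak gradient `Dw`: `w` is a `Y`-periodic, divergence-free field in
`H^1_loc(ℝ^N; ℝ)^N` with mean value zero over `Y`. -/
structure MemVY {N : ℕ} (w : Vec N → Vec N) (Dw : Vec N → Mat N) : Prop where
  memLp_loc : ∀ K : Set (Vec N), IsCompact K → MemLp w 2 (volume.restrict K)
  memLp_grad_loc : ∀ K : Set (Vec N), IsCompact K → MemLp Dw 2 (volume.restrict K)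
  weak_grad : ∀ φ : Vec N → ℝ, ContDiff ℝ ∞ φ → HasCompactSupport φ → ∀ k j : Fin N,
    ∫ y, w y k * fderiv ℝ φ y (EuclideanSpace.single j 1) = - ∫ y, Dw y (k, j) * φ y
  periodic : IsYPeriodic w
  mean_zero : ∀ k, ∫ y in cellY N, w y k = 0
  div_zero : ∀ᵐ y, ∑ k, Dw y (k, k) = 0

/-- `w ∈ L²_per(Z; V_Y)`, as a function `w(y, τ)` on `ℝ^N × ℝ` with weak `y`-gradient `Dw`. -/
structure MemL2PerVY {N : ℕ} (w : Vec N × ℝ → Vec N) (Dw : Vec N × ℝ → Mat N) : Prop where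
  aesm : AEStronglyMeasurable w volume
  aesm_grad : AEStronglyMeasurable Dw volume
  slice : ∀ᵐ τ : ℝ, MemVY (fun y => w (y, τ)) (fun y => Dw (y, τ))
  periodic : ∀ m : ℤ, ∀ᵐ p : Vec N × ℝ, w (p.1, p.2 + m) = w p
  memLp : MemLp w 2 (volume.restrict (cellYZ N))
  memLp_grad : MemLp Dw 2 (volume.restrict (cellYZ N))

/-- The space `L²_per(Z; V_Y)`; `grad` is the weak gradient in `y`. -/
structure L2PerVY (N : ℕ) where
  toFun : Vec N × ℝ → Vec N
  grad : Vec N × ℝ → Mat N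
  mem : MemL2PerVY toFun grad

/-- The space `L²(Q; L²_per(Z; V_Y))` of functions `v((x, t), (y, τ))`; `grad` is the weak gradient
in `y`. -/
structure L2QPerVY {N : ℕ} (Ω : Set (Vec N)) (T : ℝ) where
  toFun : (Vec N × ℝ) × (Vec N × ℝ) → Vec N
  grad : (Vec N × ℝ) × (Vec N × ℝ) → Mat N
  aesm : AEStronglyMeasurable toFun ((volume.restrict (cyl Ω T)).prod volume)
  aesm_grad : AEStronglyMeasurable grad ((volume.restrict (cyl Ω T)).prod volume)
  slice : ∀ᵐ q ∂volume.restrict (cyl Ω T),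
    MemL2PerVY (fun p => toFun (q, p)) (fun p => grad (q, p))
  memLp : MemLp toFun 2 (volume.restrict (cyl Ω T ×ˢ cellYZ N))
  memLp_grad : MemLp grad 2 (volume.restrict (cyl Ω T ×ˢ cellYZ N))

/-! ### Coefficients, forms and variational problems -/

/-- The standing hypotheses on `(a_ij)`: bounded, symmetric, uniformly elliptic, `Y`-periodic. -/
structure IsAdmissible {N : ℕ} (a : Fin N → Fin N → Vec N → ℝ) : Prop where
  bounded : ∀ i j, MemLp (a i j) ⊤ volume
  symm : ∀ i j, a i j =ᵐ[volume] a j i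
  elliptic : ∃ α : ℝ, 0 < α ∧ ∀ᵐ y, ∀ ζ : Vec N,
    α * ‖ζ‖ ^ 2 ≤ ∑ i, ∑ j, a i j y * ζ j * ζ i
  periodic : ∀ i j, IsYPeriodic (a i j)

/-- The form `â` on `L²_per(Z; V_Y)`. -/
def aHat {N : ℕ} (a : Fin N → Fin N → Vec N → ℝ) (u v : L2PerVY N) : ℝ :=
  ∑ i, ∑ j, ∑ k, ∫ p in cellYZ N, a i j p.1 * u.grad p (k, j) * v.grad p (k, i)

/-- The form `â_Ω` on `V × L²(Ω; L²_per(Z; V_Y))`, written in terms of the gradients of the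
entries. -/
def aHatOmega {N : ℕ} (a : Fin N → Fin N → Vec N → ℝ) (Ω : Set (Vec N))
    (Du0 : Vec N → Mat N) (Du1 : Vec N → Vec N × ℝ → Mat N)
    (Dv0 : Vec N → Mat N) (Dv1 : Vec N → Vec N × ℝ → Mat N) : ℝ :=
  ∑ i, ∑ j, ∑ k, ∫ x in Ω, ∫ p in cellYZ N,
    a i j p.1 * (Du0 x (k, j) + Du1 x p (k, j)) * (Dv0 x (k, i) + Dv1 x p (k, i))

/-- `(u_0, u_1)` solves the two-scale homogenized variational problem with right-hand side
`f ∈ L²(0, T; V')`: `u_0 ∈ 𝒲(0, T)`, `u_0(0) = 0`, `(u_0, u_1) ∈ L²(0, T; V) × L²(Q; L²_per(Z; V_Y))`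
and the variational equation holds for all `(v_0, v_1)` in the latter product. -/
def IsGlobalSolution {N : ℕ} {Ω : Set (Vec N)} {T : ℝ} (a : Fin N → Fin N → Vec N → ℝ)
    (f : ℝ → StrongDual ℝ (V Ω)) (u0 : L2V Ω T) (u1 : L2QPerVY Ω T) : Prop :=
  VanishesAtZero u0 ∧ ∃ g : ℝ → StrongDual ℝ (V Ω), IsTimeDeriv u0 g ∧
    ∀ (v0 : L2V Ω T) (v1 : L2QPerVY Ω T),
      (∫ t in Ioo 0 T, g t (v0.path t)) +
        (∫ t in Ioo 0 T, aHatOmega a Ω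
          (fun x => u0.grad (x, t)) (fun x p => u1.grad ((x, t), p))
          (fun x => v0.grad (x, t)) (fun x p => v1.grad ((x, t), p)))
      = ∫ t in Ioo 0 T, f t (v0.path t)

/-- `χ` solves the cell problem of index `(i, k)`. -/
def IsCellSolution {N : ℕ} (a : Fin N → Fin N → Vec N → ℝ) (i k : Fin N) (χ : L2PerVY N) : Prop :=
  ∀ w : L2PerVY N, aHat a χ w = ∑ l, ∫ p in cellYZ N, a l i p.1 * w.grad p (k, l)

end StokesHomogenization

end

open StokesHomogenization

namespace StokesHomogenization

open Filter Function
open scoped ENNReal Topology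

variable {N : ℕ}

/-! Everything rests on coercivity: if the energy of a `y`-gradient integrates to zero, ellipticity
makes the gradient vanish, and a field of `V_Y` with zero gradient vanishes by Poincaré's
inequality, since its mean is zero.

Uniqueness for the cell problem follows by testing the two equations with the difference of two
solutions (`IsCellSolution.ae_eq`). For existence, `V_Y` is realized as a closed subspace
`cellSpace` of pairs (field, gradient) on `Y`, and Lax-Milgram gives a stationary solution. Viewed
as independent of `τ`, it solves the problem on `Y × Z`, because almost every `τ`-slice of a test
field is itself a test field in `V_Y`.

For the formula, put `d = u_1 + ∑ ∂u_0^k/∂x_i χ_ik`, an element of `L²(Q; L²_per(Z; V_Y))`. The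
homogenized equation with `v_0 = 0` says that `∇u_0 + ∇_y u_1` is energy-orthogonal to `∇_y d`. By
linearity of the cell problems, `∇u_0 - ∑ ∂u_0^k/∂x_i ∇_y χ_ik` is orthogonal to it as well
(`integral_form_corrector_eq_zero`). The difference of these two fields is `∇_y d`, so the energy of
`∇_y d` is zero and `d = 0`.

Poincaré's inequality (`exists_poincare`) comes from a translation estimate. A weak derivative
integrates along almost every segment (`ae_sub_eq_integral_of_weakDeriv`), so `w(y + h) - w(y)` is
controlled in `L²(Y)` by `|h|` times the gradient norm. Averaging over `h` and using the zero mean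
gives the inequality. -/

/-! ### The unit cell, folding onto it, and integrals of periodic functions. -/

theorem isOpen_cellY : IsOpen (cellY N) := by
  have : cellY N = ⋂ i, {y : Vec N | y i ∈ Ioo (-(1 / 2) : ℝ) (1 / 2)} := by
    ext y; simp [cellY]
  rw [this]
  exact isOpen_iInter_of_finite fun i =>
    isOpen_Ioo.preimage (show Continuous fun y : Vec N => y i by fun_prop)

theorem measurableSet_cellY : MeasurableSet (cellY N) := isOpen_cellY.measurableSet

theorem norm_le_of_mem_cellY {y : Vec N} (hy : y ∈ cellY N) : ‖y‖ ≤ Real.sqrt N := by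
  rw [EuclideanSpace.norm_eq]
  apply Real.sqrt_le_sqrt
  calc ∑ i, ‖y i‖ ^ 2 ≤ ∑ _i : Fin N, (1 : ℝ) := by
        refine Finset.sum_le_sum fun i _ => ?_
        have := hy i
        rw [Real.norm_eq_abs, sq_abs]
        nlinarith [this.1, this.2]
    _ = N := by simp

theorem volume_cellY : volume (cellY N) = 1 := by
  have h := (PiLp.volume_preserving_ofLp (Fin N)).measure_preimage
    (s := Set.pi univ fun _ => Ioo (-(1 / 2) : ℝ) (1 / 2))
    (MeasurableSet.univ_pi fun _ => measurableSet_Ioo).nullMeasurableSet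
  have h2 : cellY N = (WithLp.ofLp : Vec N → Fin N → ℝ) ⁻¹'
      (Set.pi univ fun _ => Ioo (-(1 / 2) : ℝ) (1 / 2)) := by
    ext y; simp [cellY]
  rw [h2, h, Real.volume_pi_Ioo]
  norm_num

instance : IsProbabilityMeasure (volume.restrict (cellY N)) :=
  ⟨by rw [Measure.restrict_apply_univ, volume_cellY]⟩

theorem latticePt_apply (m : Fin N → ℤ) (i : Fin N) : (latticePt m : Vec N) i = m i := rfl

theorem latticePt_neg (m : Fin N → ℤ) : (latticePt (-m) : Vec N) = -latticePt m := by
  ext i; simp [latticePt]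

/-- The representative of a point of `ℝ^N` in the cell `[-1/2, 1/2)^N`. -/
noncomputable def wrap (y : Vec N) : Vec N :=
  WithLp.toLp 2 fun i => Int.fract (y i + 1 / 2) - 1 / 2

/-- The lattice translation taking `y` to `wrap y`. -/
noncomputable def wrapIndex (y : Vec N) : Fin N → ℤ := fun i => -⌊y i + 1 / 2⌋

theorem wrap_eq (y : Vec N) : wrap y = y + latticePt (wrapIndex y) := by
  ext i
  simp only [wrap, wrapIndex, latticePt, PiLp.add_apply, Int.fract]
  push_cast
  ring

theorem measurable_wrap : Measurable (wrap : Vec N → Vec N) := by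
  unfold wrap
  refine (WithLp.measurable_toLp 2 _).comp (measurable_pi_lambda _ fun i => ?_)
  have : Measurable fun y : Vec N => y i + 1 / 2 :=
    (show Continuous fun y : Vec N => y i + 1 / 2 by fun_prop).measurable
  exact this.fract.sub_const _

theorem wrap_add_latticePt (y : Vec N) (m : Fin N → ℤ) : wrap (y + latticePt m) = wrap y := by
  ext i
  have : y i + (m i : ℝ) + 1 / 2 = y i + 1 / 2 + (m i : ℝ) := by ring
  simp only [wrap, PiLp.add_apply, latticePt_apply, this, Int.fract_add_intCast]

theorem wrap_of_mem {y : Vec N} (hy : y ∈ cellY N) : wrap y = y := by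
  ext i
  have := hy i
  have h : Int.fract (y i + 1 / 2) = y i + 1 / 2 :=
    Int.fract_eq_self.2 ⟨by linarith [this.1], by linarith [this.2]⟩
  change Int.fract (y i + 1 / 2) - 1 / 2 = y i
  rw [h]; ring

theorem volume_coord_eq (i : Fin N) (c : ℝ) : volume {y : Vec N | y i = c} = 0 := by
  have h := (PiLp.volume_preserving_ofLp (Fin N)).measure_preimage
    (s := {f : Fin N → ℝ | f i = c}) (by
      exact (measurableSet_eq_fun (measurable_pi_apply i) measurable_const).nullMeasurableSet)
  have h2 : {y : Vec N | y i = c} = (WithLp.ofLp : Vec N → Fin N → ℝ) ⁻¹' {f | f i = c} := rfl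
  rw [h2, h]
  exact Measure.pi_hyperplane (α := fun _ : Fin N => ℝ) (fun _ => volume) i c

/-- The exceptional points lie on the countably many hyperplanes `y i = n - 1/2`, each of measure
zero. -/
theorem ae_wrap_mem : ∀ᵐ y : Vec N, wrap y ∈ cellY N := by
  have h : ∀ᵐ y : Vec N, ∀ (i : Fin N) (n : ℤ), y i ≠ n - 1 / 2 := by
    rw [ae_all_iff]; intro i
    rw [ae_all_iff]; intro n
    have := volume_coord_eq (N := N) i (n - 1 / 2)
    rwa [measure_eq_zero_iff_ae_notMem] at this
  filter_upwards [h] with y hy i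
  have h0 : Int.fract (y i + 1 / 2) ≠ 0 := by
    intro h0
    apply hy i ⌊y i + 1 / 2⌋
    have := Int.floor_add_fract (y i + 1 / 2)
    rw [h0] at this
    linarith
  have h1 := (Int.fract_nonneg (y i + 1 / 2)).lt_of_ne' h0
  have h2 := Int.fract_lt_one (y i + 1 / 2)
  simp only [wrap, mem_Ioo]
  constructor <;> linarith

theorem ae_add_latticePt {P : Vec N → Prop} (h : ∀ᵐ y, P y) :
    ∀ᵐ y, ∀ m : Fin N → ℤ, P (y + latticePt m) := by
  rw [ae_all_iff]
  intro m
  exact (measurePreserving_add_right volume (latticePt m)).quasiMeasurePreserving.ae h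

/-- `wrap` acts at each point as one of countably many lattice translations, each of which preserves
null sets. This is what makes composing a class on the cell with `wrap` well defined. -/
theorem ae_wrap {P : Vec N → Prop} (h : ∀ᵐ y ∂volume.restrict (cellY N), P y) :
    ∀ᵐ y, P (wrap y) := by
  rw [ae_restrict_iff' measurableSet_cellY] at h
  filter_upwards [ae_add_latticePt h, ae_wrap_mem] with y h1 h2
  rw [wrap_eq] at h2 ⊢
  exact h1 _ h2

theorem quasiMeasurePreserving_wrap :
    Measure.QuasiMeasurePreserving wrap volume (volume.restrict (cellY N)) := by
  refine ⟨measurable_wrap, Measure.AbsolutelyContinuous.mk fun s hs h0 => ?_⟩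
  rw [Measure.map_apply measurable_wrap hs, measure_eq_zero_iff_ae_notMem]
  rw [measure_eq_zero_iff_ae_notMem] at h0
  exact ae_wrap h0

theorem IsYPeriodic.ae_eq_wrap {F : Type*} {w : Vec N → F} (hw : IsYPeriodic w) :
    ∀ᵐ y, w (wrap y) = w y := by
  have := ae_all_iff.2 hw
  filter_upwards [this] with y hy
  rw [wrap_eq]
  exact hy _

theorem IsYPeriodic.ae_of_ae_cell {F : Type*} {w : Vec N → F} (hw : IsYPeriodic w)
    {P : F → Prop} (h : ∀ᵐ y ∂volume.restrict (cellY N), P (w y)) : ∀ᵐ y, P (w y) := by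
  filter_upwards [ae_wrap h, hw.ae_eq_wrap] with y h1 h2
  rwa [h2] at h1

theorem isYPeriodic_comp_wrap {F : Type*} (w : Vec N → F) : IsYPeriodic fun y => w (wrap y) :=
  fun m => Eventually.of_forall fun y => by simp only [wrap_add_latticePt]

theorem wrapIndex_of_add_mem {y : Vec N} {m : Fin N → ℤ} (h : y + latticePt m ∈ cellY N) :
    wrapIndex y = m := by
  have h1 := wrap_of_mem h
  rw [wrap_add_latticePt, wrap_eq] at h1
  have h2 := add_left_cancel h1
  funext i
  have h3 := congrArg (fun v : Vec N => v i) h2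
  simpa [latticePt_apply] using h3

/-- The lattice translates of the open cell are disjoint and cover the space up to a null set. -/
theorem lintegral_eq_tsum_cell (F : Vec N → ℝ≥0∞) :
    ∫⁻ y, F y = ∑' m : Fin N → ℤ, ∫⁻ y in cellY N, F (y + latticePt m) := by
  have hU : ∀ m : Fin N → ℤ, MeasurableSet {y : Vec N | y + latticePt m ∈ cellY N} := fun m =>
    (measurable_add_const _) measurableSet_cellY
  have hdis : Pairwise (Disjoint on fun m : Fin N → ℤ => {y : Vec N | y + latticePt m ∈ cellY N}) := by
    intro m m' hmm
    refine Set.disjoint_left.2 fun y h1 h2 => hmm ?_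
    rw [← wrapIndex_of_add_mem h1, ← wrapIndex_of_add_mem h2]
  have hcov : ∀ᵐ y : Vec N, y ∈ ⋃ m : Fin N → ℤ, {y : Vec N | y + latticePt m ∈ cellY N} := by
    filter_upwards [ae_wrap_mem] with y hy
    rw [wrap_eq] at hy
    exact mem_iUnion.2 ⟨_, hy⟩
  have h1 : volume.restrict (⋃ m : Fin N → ℤ, {y : Vec N | y + latticePt m ∈ cellY N}) = volume :=
    Measure.restrict_eq_self_of_ae_mem hcov
  calc ∫⁻ y, F y = ∫⁻ y in ⋃ m : Fin N → ℤ, {y : Vec N | y + latticePt m ∈ cellY N}, F y := by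
        rw [h1]
    _ = ∑' m : Fin N → ℤ, ∫⁻ y in {y : Vec N | y + latticePt m ∈ cellY N}, F y :=
        lintegral_iUnion hU hdis F
    -- The tile of index `m` is the cell shifted by `-m`; the sum is reindexed by negation
    -- afterwards.
    _ = ∑' m : Fin N → ℤ, ∫⁻ y in cellY N, F (y + latticePt (-m)) := by
        refine tsum_congr fun m => ?_
        rw [← lintegral_indicator (hU m), ← lintegral_indicator measurableSet_cellY,
          ← lintegral_add_right_eq_self _ (latticePt (-m))]
        refine lintegral_congr fun y => ?_
        by_cases hy : y ∈ cellY N <;> simp [indicator, hy, latticePt_neg]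
    _ = _ := (Equiv.neg (Fin N → ℤ)).tsum_eq fun m => ∫⁻ y in cellY N, F (y + latticePt m)

/-- Unfolding over the tiles counts each value `G y` as often as `K` contains a lattice translate of
`y`, hence at most `c` times. -/
theorem IsYPeriodic.setLIntegral_le {G : Vec N → ℝ≥0∞} (hG : IsYPeriodic G)
    (hGm : AEMeasurable G) {K : Set (Vec N)} (hK : MeasurableSet K) {c : ℝ≥0∞}
    (hc : ∀ y ∈ cellY N, ∑' m : Fin N → ℤ, K.indicator 1 (y + latticePt m) ≤ c) :
    ∫⁻ y in K, G y ≤ c * ∫⁻ y in cellY N, G y := by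
  calc ∫⁻ y in K, G y = ∑' m : Fin N → ℤ, ∫⁻ y in cellY N, K.indicator G (y + latticePt m) := by
        rw [← lintegral_indicator hK, lintegral_eq_tsum_cell]
    _ = ∑' m : Fin N → ℤ, ∫⁻ y in cellY N, K.indicator 1 (y + latticePt m) * G y := by
        refine tsum_congr fun m => lintegral_congr_ae (ae_restrict_of_ae ?_)
        filter_upwards [hG m] with y hy
        by_cases h : y + latticePt m ∈ K <;> simp [h, hy]
    _ = ∫⁻ y in cellY N, (∑' m : Fin N → ℤ, K.indicator 1 (y + latticePt m)) * G y := by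
        rw [← lintegral_tsum]
        · simp_rw [ENNReal.tsum_mul_right]
        · intro m
          refine AEMeasurable.mul ?_ hGm.restrict
          exact ((measurable_one.indicator hK).comp (measurable_add_const _)).aemeasurable
    _ ≤ ∫⁻ y in cellY N, c * G y :=
        setLIntegral_mono' measurableSet_cellY fun y hy => by gcongr; exact hc y hy
    _ = c * ∫⁻ y in cellY N, G y := lintegral_const_mul'' _ hGm.restrict

/-- Translating the cell does not increase the integral of a periodic function. -/
theorem IsYPeriodic.setLIntegral_add_le {G : Vec N → ℝ≥0∞} (hG : IsYPeriodic G)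
    (hGm : AEMeasurable G) (h : Vec N) :
    ∫⁻ y in cellY N, G (y + h) ≤ ∫⁻ y in cellY N, G y := by
  have hK : MeasurableSet {y : Vec N | y - h ∈ cellY N} :=
    (measurable_sub_const _) measurableSet_cellY
  have key : ∫⁻ y in {y : Vec N | y - h ∈ cellY N}, G y ≤ 1 * ∫⁻ y in cellY N, G y := by
    refine hG.setLIntegral_le hGm hK fun y _ => ?_
    rw [tsum_eq_single (wrapIndex (y - h))]
    · exact indicator_le_self' (by simp) _
    · intro m hm
      refine indicator_of_notMem (fun hmem => hm ?_) _
      refine (wrapIndex_of_add_mem ?_).symm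
      have : y - h + latticePt m = y + latticePt m - h := by abel
      rw [this]; exact hmem
  rw [one_mul] at key
  refine le_trans (le_of_eq ?_) key
  rw [← lintegral_indicator hK, ← lintegral_indicator measurableSet_cellY,
    ← lintegral_add_right_eq_self ({y : Vec N | y - h ∈ cellY N}.indicator _) h]
  refine lintegral_congr fun y => ?_
  by_cases hy : y ∈ cellY N <;> simp [indicator, hy]

theorem exists_setLIntegral_le_of_isBounded {K : Set (Vec N)} (hK : MeasurableSet K)
    (hKb : Bornology.IsBounded K) :
    ∃ c : ℝ≥0∞, c ≠ ⊤ ∧ ∀ G : Vec N → ℝ≥0∞, IsYPeriodic G → AEMeasurable G →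
      ∫⁻ y in K, G y ≤ c * ∫⁻ y in cellY N, G y := by
  obtain ⟨R, hR⟩ := hKb.exists_norm_le
  -- If `y` is in the cell and `y + m` has norm at most `R`, then `|m i| ≤ R + 1/2`, so only
  -- finitely many `m` count.
  obtain ⟨n, hn⟩ := exists_nat_gt (R + 1)
  let S : Finset (Fin N → ℤ) := Finset.Icc (fun _ => -(n : ℤ)) (fun _ => (n : ℤ))
  refine ⟨S.card, by simp, fun G hG hGm => hG.setLIntegral_le hGm hK fun y hy => ?_⟩
  rw [tsum_eq_sum (s := S)]
  · calc ∑ m ∈ S, K.indicator (1 : Vec N → ℝ≥0∞) (y + latticePt m) ≤ ∑ _m ∈ S, (1 : ℝ≥0∞) :=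
          Finset.sum_le_sum fun m _ => indicator_le_self' (by simp) _
      _ = S.card := by simp
  · intro m hm
    refine indicator_of_notMem (fun hmem => hm ?_) _
    have h1 : ∀ i, |(m i : ℝ)| ≤ n := by
      intro i
      have h2 : |(y + latticePt m) i| ≤ R := by
        rw [← Real.norm_eq_abs]; exact (PiLp.norm_apply_le _ i).trans (hR _ hmem)
      have h3 := hy i
      simp only [PiLp.add_apply, latticePt_apply] at h2
      rw [abs_le] at h2 ⊢
      constructor <;> linarith [h3.1, h3.2, h2.1, h2.2]
    rw [Finset.mem_Icc]
    constructor <;> intro i <;> have := abs_le.1 (h1 i)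
    · exact_mod_cast this.1
    · exact_mod_cast this.2

/-! ### Weak directional derivatives and integration along segments. -/

section WeakDerivative

variable {E : Type*} [NormedAddCommGroup E] [NormedSpace ℝ E] [FiniteDimensional ℝ E]
  [MeasurableSpace E] [BorelSpace E] {μ : Measure E} [μ.IsAddHaarMeasure]

theorem measurePreserving_shear (h : E) :
    MeasurePreserving (fun p : ℝ × E => (p.1, p.2 + p.1 • h))
      ((volume.restrict (Ioc (0 : ℝ) 1)).prod μ) ((volume.restrict (Ioc (0 : ℝ) 1)).prod μ) := by
  refine (MeasurePreserving.id _).skew_product (g := fun s y => y + s • h) ?_ ?_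
  · exact (show Continuous fun p : ℝ × E => p.2 + p.1 • h by fun_prop).measurable
  · exact Eventually.of_forall fun s => (measurePreserving_add_right μ (s • h)).map_eq

/-- For `s` in `(0, 1]` the product vanishes outside the compact set swept out by the support of `ψ`
along `h`, so `G` may be truncated there. This justifies the uses of Fubini below. -/
theorem integrable_mul_comp_sub {G ψ : E → ℝ} (hG : LocallyIntegrable G μ) (hψ : Continuous ψ)
    (hψc : HasCompactSupport ψ) (h : E) :
    Integrable (fun p : ℝ × E => G p.2 * ψ (p.2 - p.1 • h))
      ((volume.restrict (Ioc (0 : ℝ) 1)).prod μ) := by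
  have hK : IsCompact ((fun p : ℝ × E => p.2 + p.1 • h) '' (Icc (0 : ℝ) 1 ×ˢ tsupport ψ)) :=
    (isCompact_Icc.prod hψc).image (by fun_prop)
  set K := (fun p : ℝ × E => p.2 + p.1 • h) '' (Icc (0 : ℝ) 1 ×ˢ tsupport ψ) with hKdef
  have hGK : Integrable (K.indicator G) μ :=
    (integrable_indicator_iff hK.measurableSet).2 (hG.integrableOn_isCompact hK)
  have h1 : Integrable (fun p : ℝ × E => K.indicator G p.2)
      ((volume.restrict (Ioc (0 : ℝ) 1)).prod μ) := hGK.comp_snd _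
  obtain ⟨C, hC⟩ := hψ.bounded_above_of_compact_support hψc
  have h2 : Integrable (fun p : ℝ × E => K.indicator G p.2 * ψ (p.2 - p.1 • h))
      ((volume.restrict (Ioc (0 : ℝ) 1)).prod μ) :=
    h1.mul_bdd (c := C) (by fun_prop) (Eventually.of_forall fun p => hC _)
  refine h2.congr ?_
  have h3 : ∀ᵐ p ∂(volume.restrict (Ioc (0 : ℝ) 1)).prod μ, p.1 ∈ Ioc (0 : ℝ) 1 :=
    Measure.quasiMeasurePreserving_fst.ae (ae_restrict_mem measurableSet_Ioc)
  filter_upwards [h3] with p hp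
  by_cases hpK : p.2 ∈ K
  · rw [indicator_of_mem hpK]
  · have : ψ (p.2 - p.1 • h) = 0 := by
      apply image_eq_zero_of_notMem_tsupport
      intro hmem
      exact hpK ⟨(p.1, p.2 - p.1 • h), ⟨⟨hp.1.le, hp.2⟩, hmem⟩, by simp⟩
    simp [this]

theorem integrable_comp_add_mul {G ψ : E → ℝ} (hG : LocallyIntegrable G μ) (hψ : Continuous ψ)
    (hψc : HasCompactSupport ψ) (h : E) :
    Integrable (fun p : ℝ × E => G (p.2 + p.1 • h) * ψ p.2)
      ((volume.restrict (Ioc (0 : ℝ) 1)).prod μ) := by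
  have := (measurePreserving_shear (μ := μ) h).integrable_comp_of_integrable
    (integrable_mul_comp_sub hG hψ hψc h)
  simpa [Function.comp_def] using this

/-- A bump function equal to `1` on `K` reduces this to the global integrability of the preceding
lemma. -/
theorem locallyIntegrable_integral_translate {G : E → ℝ} (hG : LocallyIntegrable G μ) (h : E) :
    LocallyIntegrable (fun y => ∫ s in Ioc (0 : ℝ) 1, G (y + s • h)) μ := by
  rw [locallyIntegrable_iff]
  intro K hK
  obtain ⟨R, hR⟩ := hK.isBounded.subset_closedBall 0
  let ψ : ContDiffBump (0 : E) := ⟨max R 1, max R 1 + 1, by positivity, by linarith⟩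
  have h1 := (integrable_comp_add_mul hG ψ.continuous ψ.hasCompactSupport h).integral_prod_right
  refine (h1.integrableOn (s := K)).congr_fun (fun y hy => ?_) hK.measurableSet
  have h2 : ψ y = 1 := ψ.one_of_mem_closedBall
    (Metric.closedBall_subset_closedBall (le_max_left _ _) (hR hy))
  simp [h2]

/-- A function with a weak derivative `G` in the direction `h` is the integral of `G` along almost
every segment parallel to `h`. -/
theorem ae_sub_eq_integral_of_weakDeriv {u G : E → ℝ} (hu : LocallyIntegrable u μ)
    (hG : LocallyIntegrable G μ) (h : E)
    (hw : ∀ φ : E → ℝ, ContDiff ℝ ∞ φ → HasCompactSupport φ →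
      ∫ y, u y * fderiv ℝ φ y h ∂μ = - ∫ y, G y * φ y ∂μ) :
    ∀ᵐ y ∂μ, u (y + h) - u y = ∫ s in Ioc (0 : ℝ) 1, G (y + s • h) := by
  have huh : LocallyIntegrable (fun y => u (y + h)) μ := by
    rw [locallyIntegrable_iff]
    intro K hK
    have h1 : IsCompact ((fun y => y + h) '' K) := hK.image (by fun_prop)
    have h2 := hu.integrableOn_isCompact h1
    rwa [(measurePreserving_add_right μ h).integrableOn_image
      (measurableEmbedding_addRight h)] at h2
  -- Both sides are compared against a test function `φ`. The translation is moved onto `φ`, its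
  -- increment is written as an integral of derivatives, the weak derivative acts on each translate
  -- of `φ`, and the translations are moved back onto `G`.
  refine ae_eq_of_integral_contDiff_smul_eq (huh.sub hu)
    (locallyIntegrable_integral_translate hG h) fun φ hφ hφc => ?_
  have hφt : ∀ a : E, HasCompactSupport fun y => φ (y - a) := fun a =>
    hφc.comp_homeomorph (Homeomorph.subRight a)
  have hφd : ∀ a : E, ContDiff ℝ ∞ fun y => φ (y - a) := fun a => hφ.comp (by fun_prop)
  have hint : ∀ a : E, Integrable (fun y => u y * φ (y - a)) μ := fun a => by
    have := hu.integrable_smul_right_of_hasCompactSupport (hφd a).continuous (hφt a)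
    simpa using this
  have hint' : Integrable (fun y => u (y + h) * φ y) μ := by
    have := (hint h).comp_add_right h
    simpa using this
  have hint0 : Integrable (fun y => u y * φ y) μ := by simpa using hint 0
  have hdc : Continuous fun y => fderiv ℝ φ y h :=
    (hφ.continuous_fderiv (by simp)).clm_apply continuous_const
  have hdcs : HasCompactSupport fun y => fderiv ℝ φ y h := hφc.fderiv_apply ℝ h
  have hftc : ∀ y, φ (y - h) - φ y = ∫ s in Ioc (0 : ℝ) 1, -fderiv ℝ φ (y - s • h) h := by
    intro y
    have hd : ∀ s ∈ uIcc (0 : ℝ) 1, HasDerivAt (fun s : ℝ => φ (y - s • h))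
        (-fderiv ℝ φ (y - s • h) h) s := by
      intro s _
      have h1 : HasDerivAt (fun s : ℝ => y - s • h) (-h) s := by
        simpa using ((hasDerivAt_id s).smul_const h).const_sub y
      rw [← map_neg]
      exact ((hφ.differentiable (by simp)) (y - s • h)).hasFDerivAt.comp_hasDerivAt s h1
    have h3 := intervalIntegral.integral_eq_sub_of_hasDerivAt hd
      ((by fun_prop : Continuous fun s : ℝ => -fderiv ℝ φ (y - s • h) h).intervalIntegrable _ _)
    rw [intervalIntegral.integral_of_le zero_le_one] at h3
    simpa using h3.symm
  calc ∫ y, φ y • (u (y + h) - u y) ∂μ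
      = ∫ y, u (y + h) * φ y ∂μ - ∫ y, u y * φ y ∂μ := by
        rw [← integral_sub hint' hint0]
        congr 1; ext y; simp only [smul_eq_mul]; ring
    _ = ∫ y, u y * φ (y - h) ∂μ - ∫ y, u y * φ y ∂μ := by
        rw [← integral_add_right_eq_self (fun y => u y * φ (y - h)) h]
        simp
    _ = ∫ y, u y * (φ (y - h) - φ y) ∂μ := by
        rw [← integral_sub (hint h) hint0]
        congr 1; ext y; ring
    _ = ∫ y, (∫ s in Ioc (0 : ℝ) 1, -(u y * fderiv ℝ φ (y - s • h) h)) ∂μ := by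
        congr 1; ext y
        rw [hftc y, ← integral_const_mul]
        simp only [mul_neg]
    _ = ∫ s in Ioc (0 : ℝ) 1, ∫ y, -(u y * fderiv ℝ φ (y - s • h) h) ∂μ := by
        refine (integral_integral_swap ?_).symm
        exact (integrable_mul_comp_sub hu hdc hdcs h).neg
    _ = ∫ s in Ioc (0 : ℝ) 1, ∫ y, G y * φ (y - s • h) ∂μ := by
        congr 1; ext s
        have := hw _ (hφd (s • h)) (hφt (s • h))
        simp only [fderiv_comp_sub] at this
        rw [integral_neg, this, neg_neg]
    _ = ∫ s in Ioc (0 : ℝ) 1, ∫ y, G (y + s • h) * φ y ∂μ := by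
        congr 1; ext s
        rw [← integral_add_right_eq_self (fun y => G y * φ (y - s • h)) (s • h)]
        simp
    _ = ∫ y, (∫ s in Ioc (0 : ℝ) 1, G (y + s • h) * φ y) ∂μ :=
        integral_integral_swap (integrable_comp_add_mul hG hφ.continuous hφc h)
    _ = ∫ y, φ y • (∫ s in Ioc (0 : ℝ) 1, G (y + s • h)) ∂μ := by
        congr 1; ext y
        rw [smul_eq_mul, integral_mul_const, mul_comm]

end WeakDerivative

/-! ### Poincaré's inequality in `V_Y`. -/

/-- Cauchy-Schwarz against the constant `1`, whose norm is `1` for a probability measure. -/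
theorem sq_lintegral_le {α : Type*} [MeasurableSpace α] {μ : Measure α} [IsProbabilityMeasure μ]
    {f : α → ℝ≥0∞} (hf : AEMeasurable f μ) : (∫⁻ x, f x ∂μ) ^ 2 ≤ ∫⁻ x, f x ^ 2 ∂μ := by
  have h := ENNReal.lintegral_mul_le_Lp_mul_Lq μ Real.HolderConjugate.two_two hf
    (aemeasurable_const (b := (1 : ℝ≥0∞)))
  simp only [Pi.mul_apply, mul_one, ENNReal.one_rpow, lintegral_one, measure_univ] at h
  calc (∫⁻ x, f x ∂μ) ^ 2 ≤ ((∫⁻ x, f x ^ (2 : ℝ) ∂μ) ^ (1 / 2 : ℝ)) ^ 2 := by gcongr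
    _ = ∫⁻ x, f x ^ 2 ∂μ := by
      rw [← ENNReal.rpow_natCast, ← ENNReal.rpow_mul]
      norm_num

namespace MemVY

variable {w : Vec N → Vec N} {Dw : Vec N → Mat N}

theorem locallyIntegrable (hw : MemVY w Dw) : LocallyIntegrable w :=
  (locallyIntegrable_iff).2 fun K hK => by
    have : IsFiniteMeasure (volume.restrict K) := ⟨by simpa using hK.measure_lt_top⟩
    exact (hw.memLp_loc K hK).integrable (by norm_num)

theorem locallyIntegrable_grad (hw : MemVY w Dw) : LocallyIntegrable Dw :=
  (locallyIntegrable_iff).2 fun K hK => by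
    have : IsFiniteMeasure (volume.restrict K) := ⟨by simpa using hK.measure_lt_top⟩
    exact (hw.memLp_grad_loc K hK).integrable (by norm_num)

theorem locallyIntegrable_apply (hw : MemVY w Dw) (k : Fin N) :
    LocallyIntegrable fun y => w y k :=
  (locallyIntegrable_iff).2 fun _ hK => (EuclideanSpace.proj k : Vec N →L[ℝ] ℝ).integrable_comp
    (hw.locallyIntegrable.integrableOn_isCompact hK)

theorem locallyIntegrable_grad_apply (hw : MemVY w Dw) (p : Fin N × Fin N) :
    LocallyIntegrable fun y => Dw y p :=
  (locallyIntegrable_iff).2 fun _ hK => (EuclideanSpace.proj p : Mat N →L[ℝ] ℝ).integrable_comp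
    (hw.locallyIntegrable_grad.integrableOn_isCompact hK)

theorem memLp_cell (hw : MemVY w Dw) : MemLp w 2 (volume.restrict (cellY N)) :=
  (hw.memLp_loc _ (isCompact_closedBall 0 (Real.sqrt N))).mono_measure
    (Measure.restrict_mono (fun y hy => by simpa using norm_le_of_mem_cellY hy) le_rfl)

theorem memLp_grad_cell (hw : MemVY w Dw) : MemLp Dw 2 (volume.restrict (cellY N)) :=
  (hw.memLp_grad_loc _ (isCompact_closedBall 0 (Real.sqrt N))).mono_measure
    (Measure.restrict_mono (fun y hy => by simpa using norm_le_of_mem_cellY hy) le_rfl)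

/-- Periodicity is required only of the field. The translated gradient is a weak gradient of the
translated field, which is the field itself, and weak gradients are unique. -/
theorem grad_periodic (hw : MemVY w Dw) : IsYPeriodic Dw := by
  intro m
  have key : ∀ p : Fin N × Fin N, ∀ᵐ y, Dw (y + latticePt m) p = Dw y p := by
    rintro ⟨k, j⟩
    have hl : LocallyIntegrable fun y => Dw (y + latticePt m) (k, j) := by
      rw [locallyIntegrable_iff]
      intro K hK
      have h1 : IsCompact ((fun y => y + latticePt m) '' K) := hK.image (by fun_prop)
      have h2 := (hw.locallyIntegrable_grad_apply (k, j)).integrableOn_isCompact h1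
      rwa [(measurePreserving_add_right volume (latticePt m)).integrableOn_image
        (measurableEmbedding_addRight _)] at h2
    refine ae_eq_of_integral_contDiff_smul_eq hl (hw.locallyIntegrable_grad_apply (k, j))
      fun φ hφ hφc => ?_
    have hφt : HasCompactSupport fun y => φ (y - latticePt m) :=
      hφc.comp_homeomorph (Homeomorph.subRight (latticePt m))
    have hφd : ContDiff ℝ ∞ fun y => φ (y - latticePt m) := hφ.comp (by fun_prop)
    have h1 := hw.weak_grad _ hφd hφt k j
    have h2 := hw.weak_grad φ hφ hφc k j
    simp only [fderiv_comp_sub] at h1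
    rw [← integral_add_right_eq_self _ (latticePt m),
      ← integral_add_right_eq_self (fun y => Dw y (k, j) * _) (latticePt m)] at h1
    simp only [add_sub_cancel_right] at h1
    have h3 : ∫ y, w (y + latticePt m) k * fderiv ℝ φ y (EuclideanSpace.single j 1)
        = ∫ y, w y k * fderiv ℝ φ y (EuclideanSpace.single j 1) := by
      refine integral_congr_ae ?_
      filter_upwards [hw.periodic m] with y hy
      rw [hy]
    rw [h3, h2, neg_inj] at h1
    simp only [smul_eq_mul, mul_comm (φ _)]
    exact h1.symm
  filter_upwards [ae_all_iff.2 key] with y hy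
  ext p
  exact hy p

theorem integrable_weak_left (hw : MemVY w Dw) {φ : Vec N → ℝ} (hφ : ContDiff ℝ ∞ φ)
    (hφc : HasCompactSupport φ) (k j : Fin N) :
    Integrable fun y => w y k * fderiv ℝ φ y (EuclideanSpace.single j 1) := by
  have hc : Continuous fun y => fderiv ℝ φ y (EuclideanSpace.single j 1) :=
    (hφ.continuous_fderiv (by simp)).clm_apply continuous_const
  have := (hw.locallyIntegrable_apply k).integrable_smul_right_of_hasCompactSupport hc
    (hφc.fderiv_apply ℝ _)
  simpa using this

theorem integrable_weak_right (hw : MemVY w Dw) {φ : Vec N → ℝ} (hφ : ContDiff ℝ ∞ φ)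
    (hφc : HasCompactSupport φ) (k j : Fin N) : Integrable fun y => Dw y (k, j) * φ y := by
  have := (hw.locallyIntegrable_grad_apply (k, j)).integrable_smul_right_of_hasCompactSupport
    hφ.continuous hφc
  simpa using this

theorem weakDeriv (hw : MemVY w Dw) (k : Fin N) (h : Vec N) (φ : Vec N → ℝ) (hφ : ContDiff ℝ ∞ φ)
    (hφc : HasCompactSupport φ) :
    ∫ y, w y k * fderiv ℝ φ y h = - ∫ y, (∑ j, h j * Dw y (k, j)) * φ y := by
  have hh : h = ∑ j, h j • EuclideanSpace.single j (1 : ℝ) := by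
    ext i
    simp [Finset.sum_apply, Pi.single_apply]
  have e1 : ∀ y, w y k * fderiv ℝ φ y h
      = ∑ j, h j * (w y k * fderiv ℝ φ y (EuclideanSpace.single j 1)) := fun y => by
    conv_lhs => rw [hh]
    rw [map_sum, Finset.mul_sum]
    exact Finset.sum_congr rfl fun j _ => by rw [map_smul, smul_eq_mul]; ring
  have e2 : ∀ y, (∑ j, h j * Dw y (k, j)) * φ y = ∑ j, h j * (Dw y (k, j) * φ y) := fun y => by
    rw [Finset.sum_mul]
    exact Finset.sum_congr rfl fun j _ => by ring
  simp only [e1, e2]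
  rw [integral_finsetSum _ fun j _ => (hw.integrable_weak_left hφ hφc k j).const_mul _,
    integral_finsetSum _ fun j _ => (hw.integrable_weak_right hφ hφc k j).const_mul _, ← Finset.sum_neg_distrib]
  refine Finset.sum_congr rfl fun j _ => ?_
  rw [integral_const_mul, integral_const_mul, hw.weak_grad φ hφ hφc k j, mul_neg]

theorem norm_directional_le (G : Mat N) (k : Fin N) (h : Vec N) :
    ‖∑ j, h j * G (k, j)‖ₑ ≤ N * ‖h‖ₑ * ‖G‖ₑ := by
  have h1 : ‖∑ j, h j * G (k, j)‖ ≤ N * ‖h‖ * ‖G‖ := by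
    calc ‖∑ j, h j * G (k, j)‖ ≤ ∑ _j : Fin N, ‖h‖ * ‖G‖ := by
          refine norm_sum_le_of_le _ fun j _ => ?_
          rw [norm_mul]
          exact mul_le_mul (PiLp.norm_apply_le h j) (PiLp.norm_apply_le G (k, j)) (norm_nonneg _)
            (norm_nonneg _)
      _ = N * ‖h‖ * ‖G‖ := by simp; ring
  rw [← ofReal_norm, ← ofReal_norm, ← ofReal_norm, ← ENNReal.ofReal_natCast,
    ← ENNReal.ofReal_mul (by positivity), ← ENNReal.ofReal_mul (by positivity)]
  exact ENNReal.ofReal_le_ofReal h1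

/-- The increment is the integral of the directional derivative over a segment. Jensen and Tonelli
reduce the estimate to translates of the cell, and periodicity of the gradient removes the
translation. -/
theorem lintegral_translate_sub_le (hw : MemVY w Dw) (k : Fin N) (h : Vec N) :
    ∫⁻ y in cellY N, ‖w (y + h) k - w y k‖ₑ ^ 2
      ≤ (N * ‖h‖ₑ) ^ 2 * ∫⁻ y in cellY N, ‖Dw y‖ₑ ^ 2 := by
  set G : Vec N → ℝ := fun y => ∑ j, h j * Dw y (k, j) with hGdef
  have hG : LocallyIntegrable G := by
    rw [locallyIntegrable_iff]
    intro K hK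
    exact integrable_finsetSum _ fun j _ =>
      ((hw.locallyIntegrable_grad_apply (k, j)).integrableOn_isCompact hK).const_mul _
  have hGm : AEMeasurable (fun y => ‖G y‖ₑ ^ 2) :=
    hG.aestronglyMeasurable.enorm.pow_const 2
  have hGper : IsYPeriodic fun y => ‖G y‖ₑ ^ 2 := fun m => by
    filter_upwards [hw.grad_periodic m] with y hy
    simp only [hGdef, hy]
  have hform := ae_sub_eq_integral_of_weakDeriv (hw.locallyIntegrable_apply k) hG h
    (hw.weakDeriv k h)
  have hqmp : Measure.QuasiMeasurePreserving (fun p : ℝ × Vec N => p.2 + p.1 • h)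
      ((volume.restrict (Ioc (0 : ℝ) 1)).prod volume) volume :=
    Measure.quasiMeasurePreserving_snd.comp
      (measurePreserving_shear (μ := (volume : Measure (Vec N))) h).quasiMeasurePreserving
  have hm : AEMeasurable (fun p : ℝ × Vec N => ‖G (p.2 + p.1 • h)‖ₑ)
      ((volume.restrict (Ioc (0 : ℝ) 1)).prod volume) :=
    hG.aestronglyMeasurable.enorm.comp_quasiMeasurePreserving hqmp
  have hm' : AEMeasurable (fun p : ℝ × Vec N => ‖G (p.2 + p.1 • h)‖ₑ)
      ((volume.restrict (Ioc (0 : ℝ) 1)).prod (volume.restrict (cellY N))) :=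
    hm.mono_measure (Measure.prod_mono le_rfl Measure.restrict_le_self)
  have hms : ∀ᵐ y : Vec N, AEMeasurable (fun s : ℝ => ‖G (y + s • h)‖ₑ)
      (volume.restrict (Ioc (0 : ℝ) 1)) := by
    have h1 := (hm.comp_quasiMeasurePreserving
      (Measure.measurePreserving_swap (μ := (volume : Measure (Vec N)))
        (ν := volume.restrict (Ioc (0 : ℝ) 1))).quasiMeasurePreserving)
    exact h1.aestronglyMeasurable.prodMk_left.mono fun y hy => hy.aemeasurable
  have : IsProbabilityMeasure (volume.restrict (Ioc (0 : ℝ) 1)) := ⟨by simp⟩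
  calc ∫⁻ y in cellY N, ‖w (y + h) k - w y k‖ₑ ^ 2
      ≤ ∫⁻ y in cellY N, ∫⁻ s in Ioc (0 : ℝ) 1, ‖G (y + s • h)‖ₑ ^ 2 := by
        refine lintegral_mono_ae (ae_restrict_of_ae ?_)
        filter_upwards [hform, hms] with y h1 h2
        rw [h1]
        exact (pow_le_pow_left' (enorm_integral_le_lintegral_enorm _) 2).trans (sq_lintegral_le h2)
    _ = ∫⁻ s in Ioc (0 : ℝ) 1, ∫⁻ y in cellY N, ‖G (y + s • h)‖ₑ ^ 2 :=
        (lintegral_lintegral_swap (f := fun s y => ‖G (y + s • h)‖ₑ ^ 2) (hm'.pow_const 2)).symm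
    _ ≤ ∫⁻ _s in Ioc (0 : ℝ) 1, ∫⁻ y in cellY N, ‖G y‖ₑ ^ 2 :=
        lintegral_mono fun s => hGper.setLIntegral_add_le hGm (s • h)
    _ = ∫⁻ y in cellY N, ‖G y‖ₑ ^ 2 := by simp
    _ ≤ ∫⁻ y in cellY N, (N * ‖h‖ₑ) ^ 2 * ‖Dw y‖ₑ ^ 2 := by
        refine lintegral_mono fun y => ?_
        rw [← mul_pow]
        exact pow_le_pow_left' (norm_directional_le _ k h) 2
    _ = _ := lintegral_const_mul'' _
        (hw.memLp_grad_cell.aestronglyMeasurable.enorm.pow_const 2)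

/-- As the mean is zero and the cell has measure `1`, `w y k` is the average of its differences with
`w z k`. These are increments by `h = z - y`, to which the translation estimate applies. -/
theorem lintegral_apply_sq_le (hw : MemVY w Dw) (k : Fin N) :
    ∫⁻ y in cellY N, ‖w y k‖ₑ ^ 2 ≤
      (N * ENNReal.ofReal (2 * Real.sqrt N)) ^ 2 *
        volume (Metric.closedBall (0 : Vec N) (2 * Real.sqrt N)) *
        ∫⁻ y in cellY N, ‖Dw y‖ₑ ^ 2 := by
  set B := Metric.closedBall (0 : Vec N) (2 * Real.sqrt N) with hB
  have hu := (hw.locallyIntegrable_apply k).aestronglyMeasurable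
  have hui : Integrable (fun y => w y k) (volume.restrict (cellY N)) :=
    ((EuclideanSpace.proj k : Vec N →L[ℝ] ℝ).integrable_comp
      (hw.memLp_cell.integrable (by norm_num)))
  have hmean : ∀ y, w y k = ∫ z in cellY N, (w y k - w z k) := fun y => by
    rw [integral_sub (integrable_const _) hui, hw.mean_zero k]
    simp
  have hqmp : Measure.QuasiMeasurePreserving (fun p : Vec N × Vec N => p.2 + p.1)
      (volume.prod volume) volume := quasiMeasurePreserving_add_swap volume volume
  have hm : AEMeasurable (fun p : Vec N × Vec N => ‖w (p.2 + p.1) k - w p.2 k‖ₑ ^ 2)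
      ((volume.restrict B).prod (volume.restrict (cellY N))) := by
    refine AEMeasurable.mono_measure ?_
      (Measure.prod_mono Measure.restrict_le_self Measure.restrict_le_self)
    exact ((hu.comp_quasiMeasurePreserving hqmp).sub
      (hu.comp_quasiMeasurePreserving Measure.quasiMeasurePreserving_snd)).enorm.pow_const 2
  calc ∫⁻ y in cellY N, ‖w y k‖ₑ ^ 2
      ≤ ∫⁻ y in cellY N, ∫⁻ z in cellY N, ‖w y k - w z k‖ₑ ^ 2 := by
        refine lintegral_mono fun y => ?_
        have h1 : ‖w y k‖ₑ ≤ ∫⁻ z in cellY N, ‖w y k - w z k‖ₑ := by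
          conv_lhs => rw [hmean y]
          exact enorm_integral_le_lintegral_enorm _
        exact (pow_le_pow_left' h1 2).trans (sq_lintegral_le (aestronglyMeasurable_const.sub hu.restrict).enorm)
    -- Substitution `z = y + h`: two points of the cell have norm at most `√N`, so `‖h‖ ≤ 2√N` and
    -- `h` lies in `B`.
    _ ≤ ∫⁻ y in cellY N, ∫⁻ h in B, ‖w (y + h) k - w y k‖ₑ ^ 2 := by
        refine setLIntegral_mono' measurableSet_cellY fun y hy => ?_
        rw [← lintegral_indicator measurableSet_cellY,
          ← lintegral_indicator Metric.isClosed_closedBall.measurableSet,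
          ← lintegral_add_left_eq_self _ y]
        refine lintegral_mono fun h => ?_
        by_cases hh : y + h ∈ cellY N
        · have hhB : h ∈ B := by
            have h1 := norm_sub_le (y + h) y
            rw [add_sub_cancel_left] at h1
            rw [hB, mem_closedBall_zero_iff]
            linarith [norm_le_of_mem_cellY hh, norm_le_of_mem_cellY hy]
          rw [indicator_of_mem hh, indicator_of_mem hhB, enorm_sub_rev]
        · rw [indicator_of_notMem hh]
          exact zero_le
    _ = ∫⁻ h in B, ∫⁻ y in cellY N, ‖w (y + h) k - w y k‖ₑ ^ 2 :=
        (lintegral_lintegral_swap (f := fun h y => ‖w (y + h) k - w y k‖ₑ ^ 2) hm).symm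
    _ ≤ ∫⁻ _h in B, (N * ENNReal.ofReal (2 * Real.sqrt N)) ^ 2 *
          ∫⁻ y in cellY N, ‖Dw y‖ₑ ^ 2 := by
        refine setLIntegral_mono' Metric.isClosed_closedBall.measurableSet fun h hh => ?_
        refine (hw.lintegral_translate_sub_le k h).trans ?_
        rw [hB, mem_closedBall_zero_iff] at hh
        gcongr
        rw [← ofReal_norm]
        exact ENNReal.ofReal_le_ofReal hh
    _ = _ := by
        rw [lintegral_const, Measure.restrict_apply_univ]
        ring

end MemVY

theorem enorm_sq_eq_sum {ι : Type*} [Fintype ι] (v : EuclideanSpace ℝ ι) :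
    ‖v‖ₑ ^ 2 = ∑ i, ‖v i‖ₑ ^ 2 := by
  simp only [← ofReal_norm, ← ENNReal.ofReal_pow (norm_nonneg _)]
  rw [← ENNReal.ofReal_sum_of_nonneg fun i _ => by positivity, EuclideanSpace.norm_sq_eq]

/-- Poincaré's inequality in `V_Y`. -/
theorem exists_poincare (N : ℕ) : ∃ C : ℝ≥0∞, C ≠ ⊤ ∧
    ∀ (w : Vec N → Vec N) (Dw : Vec N → Mat N), MemVY w Dw →
      ∫⁻ y in cellY N, ‖w y‖ₑ ^ 2 ≤ C * ∫⁻ y in cellY N, ‖Dw y‖ₑ ^ 2 := by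
  refine ⟨N * ((N * ENNReal.ofReal (2 * Real.sqrt N)) ^ 2 *
        volume (Metric.closedBall (0 : Vec N) (2 * Real.sqrt N))), ?_, fun w Dw hw => ?_⟩
  · refine ENNReal.mul_ne_top (by simp) (ENNReal.mul_ne_top (ENNReal.pow_ne_top
      (ENNReal.mul_ne_top (by simp) ENNReal.ofReal_ne_top)) measure_closedBall_lt_top.ne)
  · simp only [enorm_sq_eq_sum (w _)]
    rw [lintegral_finsetSum' _ fun k _ =>
      (hw.locallyIntegrable_apply k).aestronglyMeasurable.restrict.enorm.pow_const 2]
    refine (Finset.sum_le_sum fun k _ => hw.lintegral_apply_sq_le k).trans ?_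
    simp [mul_assoc]

theorem MemVY.ae_eq_zero {w : Vec N → Vec N} {Dw : Vec N → Mat N} (hw : MemVY w Dw)
    (h0 : ∀ᵐ y ∂volume.restrict (cellY N), Dw y = 0) : ∀ᵐ y, w y = 0 := by
  obtain ⟨C, -, hC⟩ := exists_poincare N
  have h1 : ∫⁻ y in cellY N, ‖Dw y‖ₑ ^ 2 = 0 := by
    rw [lintegral_eq_zero_iff' (hw.memLp_grad_cell.aestronglyMeasurable.enorm.pow_const 2)]
    filter_upwards [h0] with y hy
    simp [hy]
  have h2 : ∫⁻ y in cellY N, ‖w y‖ₑ ^ 2 = 0 := by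
    have := hC w Dw hw
    rw [h1, mul_zero] at this
    exact le_antisymm this zero_le
  rw [lintegral_eq_zero_iff' (hw.memLp_cell.aestronglyMeasurable.enorm.pow_const 2)] at h2
  refine hw.periodic.ae_of_ae_cell (P := fun v => v = 0) ?_
  filter_upwards [h2] with y hy
  simpa using hy

/-! ### From slices to the product: fields with zero `y`-gradient. -/

/-- The zero set of `f` need not be measurable, so Fubini for null sets is applied to a strongly
measurable representative. -/
theorem ae_prod_eq_zero_of_ae_ae {α β F : Type*} [MeasurableSpace α] [MeasurableSpace β]
    {μ : Measure α} {ν : Measure β} [SFinite ν] [NormedAddCommGroup F]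
    {f : α × β → F} (hf : AEStronglyMeasurable f (μ.prod ν))
    (h : ∀ᵐ x ∂μ, ∀ᵐ y ∂ν, f (x, y) = 0) : ∀ᵐ p ∂μ.prod ν, f p = 0 := by
  borelize F
  have h2 : ∀ᵐ p ∂μ.prod ν, hf.mk _ p = 0 := by
    refine (Measure.ae_prod_iff_ae_ae (p := fun p => hf.mk f p = 0)
      (hf.stronglyMeasurable_mk.measurable (measurableSet_singleton 0))).2 ?_
    filter_upwards [Measure.ae_ae_of_ae_prod hf.ae_eq_mk, h] with x h3 h4
    filter_upwards [h3, h4] with y h5 h6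
    rw [← h5, h6]
  filter_upwards [h2, hf.ae_eq_mk] with p h3 h4
  rw [h4, h3]

/-- A field of `L²_per(Z; V_Y)` whose `y`-gradient vanishes on `Y × Z` vanishes. -/
theorem MemL2PerVY.ae_eq_zero {w : Vec N × ℝ → Vec N} {Dw : Vec N × ℝ → Mat N}
    (hw : MemL2PerVY w Dw) (h0 : ∀ᵐ p ∂volume.restrict (cellYZ N), Dw p = 0) :
    ∀ᵐ p, w p = 0 := by
  have hZ : ∀ᵐ τ : ℝ, τ ∈ Ioo (-(1 / 2) : ℝ) (1 / 2) → ∀ᵐ y : Vec N, w (y, τ) = 0 := by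
    have h1 : (volume.restrict (cellYZ N) : Measure (Vec N × ℝ))
        = (volume.restrict (cellY N)).prod (volume.restrict (Ioo (-(1 / 2) : ℝ) (1 / 2))) := by
      rw [Measure.prod_restrict]; rfl
    rw [h1] at h0
    have h2 := Measure.ae_ae_of_ae_prod (Measure.measurePreserving_swap.quasiMeasurePreserving.ae h0)
    rw [ae_restrict_iff' measurableSet_Ioo] at h2
    filter_upwards [h2, hw.slice] with τ h3 h4 h5
    exact h4.ae_eq_zero (h3 h5)
  have hper : ∀ᵐ τ : ℝ, ∀ m : ℤ, ∀ᵐ y : Vec N, w (y, τ + m) = w (y, τ) := by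
    rw [ae_all_iff]
    intro m
    exact Measure.ae_ae_of_ae_prod
      (Measure.measurePreserving_swap.quasiMeasurePreserving.ae (hw.periodic m))
  have hZ' : ∀ᵐ τ : ℝ, ∀ m : ℤ, τ + m ∈ Ioo (-(1 / 2) : ℝ) (1 / 2) →
      ∀ᵐ y : Vec N, w (y, τ + m) = 0 := by
    rw [ae_all_iff]
    intro m
    exact (measurePreserving_add_right volume (m : ℝ)).quasiMeasurePreserving.ae hZ
  -- The gradient is known to vanish only for `τ` in `Z`; every other `τ` outside the countable set
  -- `ℤ - 1/2` is shifted into `Z` by an integer, and periodicity in `τ` carries the conclusion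
  -- over.
  have hcov : ∀ᵐ τ : ℝ, ∃ m : ℤ, τ + m ∈ Ioo (-(1 / 2) : ℝ) (1 / 2) := by
    have h : ∀ᵐ τ : ℝ, ∀ n : ℤ, τ ≠ n - 1 / 2 := by
      rw [ae_all_iff]; intro n
      exact Measure.ae_ne volume _
    filter_upwards [h] with τ hτ
    refine ⟨-⌊τ + 1 / 2⌋, ?_⟩
    have h0 : Int.fract (τ + 1 / 2) ≠ 0 := by
      intro h0
      apply hτ ⌊τ + 1 / 2⌋
      have := Int.floor_add_fract (τ + 1 / 2)
      rw [h0] at this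
      linarith
    have h1 := (Int.fract_nonneg (τ + 1 / 2)).lt_of_ne' h0
    have h2 := Int.fract_lt_one (τ + 1 / 2)
    unfold Int.fract at h1 h2
    push_cast
    constructor <;> linarith
  have hall : ∀ᵐ τ : ℝ, ∀ᵐ y : Vec N, w (y, τ) = 0 := by
    filter_upwards [hper, hZ', hcov] with τ h1 h2 ⟨m, hm⟩
    filter_upwards [h1 m, h2 m hm] with y h3 h4
    rw [← h3, h4]
  have hsw : AEStronglyMeasurable (fun p : ℝ × Vec N => w p.swap) (volume.prod volume) :=
    hw.aesm.comp_measurePreserving Measure.measurePreserving_swap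
  exact Measure.measurePreserving_swap.quasiMeasurePreserving.ae
    (ae_prod_eq_zero_of_ae_ae hsw hall)

/-! ### The pointwise energy form: linearity, boundedness, coercivity. -/

/-- The energy density `∑ a_ij(y) G_kj H_ki` of two gradient matrices. -/
def form (a : Fin N → Fin N → Vec N → ℝ) (y : Vec N) (G H : Mat N) : ℝ :=
  ∑ i, ∑ j, ∑ k, a i j y * G (k, j) * H (k, i)

section Algebra

variable (a : Fin N → Fin N → Vec N → ℝ) (y : Vec N)

theorem form_add_left (G G' H : Mat N) : form a y (G + G') H = form a y G H + form a y G' H := by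
  simp [form, mul_add, add_mul, Finset.sum_add_distrib]

theorem form_add_right (G H H' : Mat N) : form a y G (H + H') = form a y G H + form a y G H' := by
  simp [form, mul_add, Finset.sum_add_distrib]

theorem form_smul_left (c : ℝ) (G H : Mat N) : form a y (c • G) H = c * form a y G H := by
  simp only [form, Finset.mul_sum, PiLp.smul_apply, smul_eq_mul]
  exact Finset.sum_congr rfl fun i _ => Finset.sum_congr rfl fun j _ =>
    Finset.sum_congr rfl fun k _ => by ring

theorem form_smul_right (c : ℝ) (G H : Mat N) : form a y G (c • H) = c * form a y G H := by
  simp only [form, Finset.mul_sum, PiLp.smul_apply, smul_eq_mul]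
  exact Finset.sum_congr rfl fun i _ => Finset.sum_congr rfl fun j _ =>
    Finset.sum_congr rfl fun k _ => by ring

theorem form_sub_left (G G' H : Mat N) : form a y (G - G') H = form a y G H - form a y G' H := by
  simp [form, mul_sub, sub_mul, Finset.sum_sub_distrib]

theorem form_sum_left {ι : Type*} (s : Finset ι) (G : ι → Mat N) (H : Mat N) :
    form a y (∑ c ∈ s, G c) H = ∑ c ∈ s, form a y (G c) H := by
  classical
  induction s using Finset.induction_on with
  | empty => simp [form]
  | insert c s hc ih => rw [Finset.sum_insert hc, Finset.sum_insert hc, form_add_left, ih]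

/-- Identifies the datum of the cell problem with the energy pairing against a constant gradient. -/
theorem form_single_left (i k : Fin N) (H : Mat N) :
    form a y (EuclideanSpace.single (k, i) 1) H = ∑ l, a l i y * H (k, l) := by
  unfold form
  refine Finset.sum_congr rfl fun l _ => ?_
  rw [Finset.sum_eq_single i, Finset.sum_eq_single k]
  · simp
  · intro b _ hb; simp [hb]
  · simp
  · intro b _ hb; simp [hb]
  · simp

end Algebra

namespace IsAdmissible

variable {a : Fin N → Fin N → Vec N → ℝ}

theorem exists_bound (ha : IsAdmissible a) :
    ∃ M : ℝ, 0 ≤ M ∧ ∀ᵐ y, ∀ i j, ‖a i j y‖ ≤ M := by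
  refine ⟨∑ i, ∑ j, (eLpNorm (a i j) ⊤ volume).toReal, by positivity, ?_⟩
  rw [ae_all_iff]; intro i
  rw [ae_all_iff]; intro j
  have h1 : ∀ᵐ y, ‖a i j y‖ ≤ (eLpNorm (a i j) ⊤ volume).toReal := by
    have h := ae_le_eLpNormEssSup (f := a i j) (μ := volume)
    filter_upwards [h] with y hy
    rw [← toReal_enorm]
    rw [← eLpNorm_exponent_top] at hy
    exact ENNReal.toReal_mono (ha.bounded i j).eLpNorm_ne_top hy
  filter_upwards [h1] with y hy
  refine hy.trans ?_
  have h2 := Finset.single_le_sum (f := fun j => (eLpNorm (a i j) ⊤ volume).toReal)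
    (fun _ _ => ENNReal.toReal_nonneg) (Finset.mem_univ j)
  have h3 := Finset.single_le_sum (f := fun i => ∑ j, (eLpNorm (a i j) ⊤ volume).toReal)
    (fun _ _ => Finset.sum_nonneg fun _ _ => ENNReal.toReal_nonneg) (Finset.mem_univ i)
  exact h2.trans h3

theorem exists_form_bound (ha : IsAdmissible a) :
    ∃ M : ℝ, 0 ≤ M ∧ ∀ᵐ y, ∀ G H : Mat N, ‖form a y G H‖ ≤ M * (‖G‖ * ‖H‖) := by
  obtain ⟨M, hM0, hM⟩ := ha.exists_bound
  refine ⟨∑ _i : Fin N, ∑ _j : Fin N, ∑ _k : Fin N, M, by positivity, ?_⟩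
  filter_upwards [hM] with y hy G H
  simp only [Finset.sum_mul]
  refine norm_sum_le_of_le _ fun i _ => norm_sum_le_of_le _ fun j _ =>
    norm_sum_le_of_le _ fun k _ => ?_
  rw [norm_mul, norm_mul, mul_assoc]
  exact mul_le_mul (hy i j) (mul_le_mul (PiLp.norm_apply_le G _) (PiLp.norm_apply_le H _)
    (norm_nonneg _) (norm_nonneg _)) (by positivity) hM0

/-- The form decouples over the components `k`, and ellipticity applies to each row of `G`
separately. -/
theorem exists_form_coercive (ha : IsAdmissible a) :
    ∃ α : ℝ, 0 < α ∧ ∀ᵐ y, ∀ G : Mat N, α * ‖G‖ ^ 2 ≤ form a y G G := by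
  obtain ⟨α, hα, h⟩ := ha.elliptic
  refine ⟨α, hα, ?_⟩
  filter_upwards [h] with y hy G
  have h1 : form a y G G = ∑ k, ∑ i, ∑ j, a i j y * G (k, j) * G (k, i) := by
    unfold form
    refine Eq.trans (Finset.sum_congr rfl fun i _ => Finset.sum_comm) Finset.sum_comm
  rw [h1, EuclideanSpace.norm_sq_eq, Fintype.sum_prod_type, Finset.mul_sum]
  refine Finset.sum_le_sum fun k _ => ?_
  have h2 := hy (WithLp.toLp 2 fun j => G (k, j))
  rwa [EuclideanSpace.norm_sq_eq] at h2

variable {X : Type*} [MeasurableSpace X] {μ : Measure X} {π : X → Vec N} {G H : X → Mat N}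

/-- The map `π` extracts the variable `y`, so that the same statements serve on `Y`, on `Y × Z` and
on `Q × Y × Z`. -/
theorem integrable_form_term (ha : IsAdmissible a) (hπ : Measure.QuasiMeasurePreserving π μ volume)
    (hG : MemLp G 2 μ) (hH : MemLp H 2 μ) (i j k : Fin N) :
    Integrable (fun x => a i j (π x) * G x (k, j) * H x (k, i)) μ := by
  obtain ⟨M, -, hM⟩ := ha.exists_bound
  have h1 : MemLp (fun x => G x (k, j)) 2 μ :=
    (EuclideanSpace.proj (k, j) : Mat N →L[ℝ] ℝ).comp_memLp' hG
  have h2 : MemLp (fun x => H x (k, i)) 2 μ :=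
    (EuclideanSpace.proj (k, i) : Mat N →L[ℝ] ℝ).comp_memLp' hH
  have h3 : Integrable (fun x => a i j (π x) * (G x (k, j) * H x (k, i))) μ := by
    refine (h1.integrable_mul h2).bdd_mul (c := M)
      ((ha.bounded i j).aestronglyMeasurable.comp_quasiMeasurePreserving hπ) ?_
    filter_upwards [hπ.ae hM] with x hx
    exact hx i j
  simpa only [mul_assoc] using h3

theorem integrable_form (ha : IsAdmissible a) (hπ : Measure.QuasiMeasurePreserving π μ volume)
    (hG : MemLp G 2 μ) (hH : MemLp H 2 μ) : Integrable (fun x => form a (π x) (G x) (H x)) μ :=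
  integrable_finsetSum _ fun i _ => integrable_finsetSum _ fun j _ =>
    integrable_finsetSum _ fun k _ => ha.integrable_form_term hπ hG hH i j k

theorem integral_form (ha : IsAdmissible a) (hπ : Measure.QuasiMeasurePreserving π μ volume)
    (hG : MemLp G 2 μ) (hH : MemLp H 2 μ) :
    ∫ x, form a (π x) (G x) (H x) ∂μ
      = ∑ i, ∑ j, ∑ k, ∫ x, a i j (π x) * G x (k, j) * H x (k, i) ∂μ := by
  have h := ha.integrable_form_term hπ hG hH
  unfold form
  rw [integral_finsetSum _ fun i _ => integrable_finsetSum _ fun j _ =>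
    integrable_finsetSum _ fun k _ => h i j k]
  refine Finset.sum_congr rfl fun i _ => ?_
  rw [integral_finsetSum _ fun j _ => integrable_finsetSum _ fun k _ => h i j k]
  refine Finset.sum_congr rfl fun j _ => ?_
  rw [integral_finsetSum _ fun k _ => h i j k]

theorem ae_eq_zero_of_integral_form_eq_zero (ha : IsAdmissible a)
    (hπ : Measure.QuasiMeasurePreserving π μ volume) (hG : MemLp G 2 μ)
    (h0 : ∫ x, form a (π x) (G x) (G x) ∂μ = 0) : ∀ᵐ x ∂μ, G x = 0 := by
  obtain ⟨α, hα, hc⟩ := ha.exists_form_coercive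
  have hc' := hπ.ae hc
  have h1 := (integral_eq_zero_iff_of_nonneg_ae (by
    filter_upwards [hc'] with x hx
    exact le_trans (by positivity) (hx (G x))) (ha.integrable_form hπ hG hG)).1 h0
  filter_upwards [hc', h1] with x h2 h3
  have h4 := h2 (G x)
  rw [Pi.zero_apply] at h3
  rw [h3] at h4
  have h5 : ‖G x‖ ^ 2 ≤ 0 := by
    by_contra hcon
    push Not at hcon
    nlinarith
  exact norm_eq_zero.1 (pow_eq_zero_iff two_ne_zero |>.1 (le_antisymm h5 (by positivity)))

end IsAdmissible

theorem quasiMeasurePreserving_fst_cellYZ :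
    Measure.QuasiMeasurePreserving (Prod.fst : Vec N × ℝ → Vec N) (volume.restrict (cellYZ N))
      volume :=
  Measure.quasiMeasurePreserving_fst.mono_left Measure.absolutelyContinuous_restrict

theorem aHat_eq {a : Fin N → Fin N → Vec N → ℝ} (ha : IsAdmissible a) (u v : L2PerVY N) :
    aHat a u v = ∫ p in cellYZ N, form a p.1 (u.grad p) (v.grad p) :=
  (ha.integral_form quasiMeasurePreserving_fst_cellYZ u.mem.memLp_grad v.mem.memLp_grad).symm

theorem restrict_cellYZ : (volume.restrict (cellYZ N) : Measure (Vec N × ℝ))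
    = (volume.restrict (cellY N)).prod (volume.restrict (Ioo (-(1 / 2) : ℝ) (1 / 2))) := by
  rw [Measure.prod_restrict]; rfl

instance : IsProbabilityMeasure (volume.restrict (Ioo (-(1 / 2) : ℝ) (1 / 2))) :=
  ⟨by simp; norm_num⟩

instance : IsProbabilityMeasure (volume.restrict (cellYZ N) : Measure (Vec N × ℝ)) := by
  rw [restrict_cellYZ]; infer_instance

/-- In this form both sides are energies, so cell problems can be combined linearly and subtracted.
-/
theorem isCellSolution_iff {a : Fin N → Fin N → Vec N → ℝ} (ha : IsAdmissible a) {i k : Fin N}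
    {χ : L2PerVY N} : IsCellSolution a i k χ ↔ ∀ w : L2PerVY N,
      ∫ p in cellYZ N, form a p.1 (χ.grad p) (w.grad p)
        = ∫ p in cellYZ N, form a p.1 (EuclideanSpace.single (k, i) 1) (w.grad p) := by
  refine forall_congr' fun w => ?_
  rw [aHat_eq ha]
  have h : ∫ p in cellYZ N, form a p.1 (EuclideanSpace.single (k, i) 1) (w.grad p)
      = ∑ l, ∫ p in cellYZ N, a l i p.1 * w.grad p (k, l) := by
    simp only [form_single_left]
    refine integral_finsetSum _ fun l _ => ?_
    have h1 := ha.integrable_form_term quasiMeasurePreserving_fst_cellYZ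
      (memLp_const (EuclideanSpace.single (k, i) (1 : ℝ))) w.mem.memLp_grad l i k
    simpa using h1
  rw [h]

/-! ### `V_Y` as a closed subspace of pairs (field, gradient) on the cell. -/

namespace MemVY

variable {w w' : Vec N → Vec N} {Dw Dw' : Vec N → Mat N}

theorem congr (hw : MemVY w Dw) (h : w =ᵐ[volume] w') (hD : Dw =ᵐ[volume] Dw') : MemVY w' Dw' where
  memLp_loc K hK := (hw.memLp_loc K hK).ae_eq (ae_restrict_of_ae h)
  memLp_grad_loc K hK := (hw.memLp_grad_loc K hK).ae_eq (ae_restrict_of_ae hD)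
  weak_grad φ hφ hφc k j := by
    have h1 : ∫ y, w' y k * fderiv ℝ φ y (EuclideanSpace.single j 1)
        = ∫ y, w y k * fderiv ℝ φ y (EuclideanSpace.single j 1) :=
      integral_congr_ae (by filter_upwards [h] with y hy; rw [hy])
    have h2 : ∫ y, Dw' y (k, j) * φ y = ∫ y, Dw y (k, j) * φ y :=
      integral_congr_ae (by filter_upwards [hD] with y hy; rw [hy])
    rw [h1, h2, hw.weak_grad φ hφ hφc k j]
  periodic m := by
    filter_upwards [hw.periodic m, h,
      (measurePreserving_add_right volume (latticePt m)).quasiMeasurePreserving.ae h]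
      with y h1 h2 h3
    rw [← h2, ← h3, h1]
  mean_zero k := by
    rw [← hw.mean_zero k]
    exact integral_congr_ae (ae_restrict_of_ae (by filter_upwards [h] with y hy; rw [hy]))
  div_zero := by
    filter_upwards [hw.div_zero, hD] with y h1 h2
    rw [← h2, h1]

theorem zero : MemVY (N := N) (fun _ => 0) (fun _ => 0) where
  memLp_loc _ _ := MemLp.zero'
  memLp_grad_loc _ _ := MemLp.zero'
  weak_grad _ _ _ _ _ := by simp
  periodic _ := by simp
  mean_zero _ := by simp
  div_zero := by simp

theorem smul (hw : MemVY w Dw) (c : ℝ) : MemVY (fun y => c • w y) (fun y => c • Dw y) where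
  memLp_loc K hK := (hw.memLp_loc K hK).const_smul c
  memLp_grad_loc K hK := (hw.memLp_grad_loc K hK).const_smul c
  weak_grad φ hφ hφc k j := by
    simp only [PiLp.smul_apply, smul_eq_mul, mul_assoc]
    rw [integral_const_mul, integral_const_mul, hw.weak_grad φ hφ hφc k j, mul_neg]
  periodic m := by
    filter_upwards [hw.periodic m] with y hy
    rw [hy]
  mean_zero k := by
    simp only [PiLp.smul_apply, smul_eq_mul]
    rw [integral_const_mul, hw.mean_zero k, mul_zero]
  div_zero := by
    filter_upwards [hw.div_zero] with y hy
    simp only [PiLp.smul_apply, smul_eq_mul, ← Finset.mul_sum, hy, mul_zero]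

theorem add (hw : MemVY w Dw) (hw' : MemVY w' Dw') :
    MemVY (fun y => w y + w' y) (fun y => Dw y + Dw' y) where
  memLp_loc K hK := (hw.memLp_loc K hK).add (hw'.memLp_loc K hK)
  memLp_grad_loc K hK := (hw.memLp_grad_loc K hK).add (hw'.memLp_grad_loc K hK)
  weak_grad φ hφ hφc k j := by
    simp only [PiLp.add_apply, add_mul]
    rw [integral_add (hw.integrable_weak_left hφ hφc k j) (hw'.integrable_weak_left hφ hφc k j),
      integral_add (hw.integrable_weak_right hφ hφc k j) (hw'.integrable_weak_right hφ hφc k j),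
      hw.weak_grad φ hφ hφc k j, hw'.weak_grad φ hφ hφc k j, neg_add]
  periodic m := by
    filter_upwards [hw.periodic m, hw'.periodic m] with y h1 h2
    rw [h1, h2]
  mean_zero k := by
    have hi : ∀ {v Dv}, MemVY (N := N) v Dv →
        Integrable (fun y => v y k) (volume.restrict (cellY N)) := fun hv =>
      (EuclideanSpace.proj k : Vec N →L[ℝ] ℝ).integrable_comp (hv.memLp_cell.integrable (by norm_num))
    simp only [PiLp.add_apply]
    rw [integral_add (hi hw) (hi hw'), hw.mean_zero k, hw'.mean_zero k, add_zero]
  div_zero := by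
    filter_upwards [hw.div_zero, hw'.div_zero] with y h1 h2
    simp only [PiLp.add_apply, Finset.sum_add_distrib, h1, h2, add_zero]

end MemVY

section Wrap

theorem ae_cell_comp_wrap {F : Type*} (f : Vec N → F) :
    ∀ᵐ y ∂volume.restrict (cellY N), f (wrap y) = f y := by
  filter_upwards [ae_restrict_mem measurableSet_cellY] with y hy
  rw [wrap_of_mem hy]

variable {F : Type*} [NormedAddCommGroup F]

theorem aestronglyMeasurable_comp_wrap {f : Vec N → F}
    (hf : AEStronglyMeasurable f (volume.restrict (cellY N))) :
    AEStronglyMeasurable (fun y => f (wrap y)) volume :=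
  hf.comp_quasiMeasurePreserving quasiMeasurePreserving_wrap

theorem memLp_comp_wrap {f : Vec N → F} (hf : MemLp f 2 (volume.restrict (cellY N)))
    {K : Set (Vec N)} (hK : MeasurableSet K) (hKb : Bornology.IsBounded K) :
    MemLp (fun y => f (wrap y)) 2 (volume.restrict K) := by
  have hm := aestronglyMeasurable_comp_wrap hf.aestronglyMeasurable
  obtain ⟨c, hc, h⟩ := exists_setLIntegral_le_of_isBounded hK hKb
  refine ⟨hm.restrict, ?_⟩
  have h1 := h _ (isYPeriodic_comp_wrap fun y => ‖f y‖ₑ ^ (2 : ℝ)) (hm.enorm.pow_const _)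
  have h2 : ∫⁻ y in cellY N, ‖f (wrap y)‖ₑ ^ (2 : ℝ) = ∫⁻ y in cellY N, ‖f y‖ₑ ^ (2 : ℝ) :=
    lintegral_congr_ae (by filter_upwards [ae_cell_comp_wrap f] with y hy; rw [hy])
  rw [eLpNorm_lt_top_iff_lintegral_rpow_enorm_lt_top (by norm_num) (by norm_num)]
  simp only [ENNReal.toReal_ofNat]
  refine h1.trans_lt ?_
  rw [h2]
  refine ENNReal.mul_lt_top hc.lt_top ?_
  have := (eLpNorm_lt_top_iff_lintegral_rpow_enorm_lt_top (by norm_num) (by norm_num)).1 hf.2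
  simpa only [ENNReal.toReal_ofNat] using this

variable [NormedSpace ℝ F]

/-- Testing a periodic extension against a bounded function of bounded support is continuous in
`L²(Y)`: the support meets boundedly many translates of each point, and the `L¹` norm on the
probability space `Y` is at most the `L²` norm. -/
theorem exists_wrapPairing {ψ : Vec N → ℝ} (hψ : Measurable ψ) {C : ℝ} (hC : ∀ y, ‖ψ y‖ ≤ C)
    {K : Set (Vec N)} (hK : MeasurableSet K) (hKb : Bornology.IsBounded K)
    (hψK : ∀ y, y ∉ K → ψ y = 0) :
    ∃ L : Lp F 2 (volume.restrict (cellY N)) →L[ℝ] F,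
      ∀ f, Integrable (fun y => ψ y • f (wrap y)) ∧ L f = ∫ y, ψ y • f (wrap y) := by
  obtain ⟨c, hc, h⟩ := exists_setLIntegral_le_of_isBounded hK hKb
  have hbound : ∀ f : Lp F 2 (volume.restrict (cellY N)),
      ∫⁻ y, ‖ψ y • f (wrap y)‖ₑ ≤ ENNReal.ofReal C * c * ‖f‖ₑ := by
    intro f
    have hm := aestronglyMeasurable_comp_wrap (Lp.aestronglyMeasurable f)
    calc ∫⁻ y, ‖ψ y • f (wrap y)‖ₑ ≤ ∫⁻ y, K.indicator (fun y => ENNReal.ofReal C * ‖f (wrap y)‖ₑ) y := by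
          refine lintegral_mono fun y => ?_
          by_cases hy : y ∈ K
          · rw [indicator_of_mem hy, enorm_smul]
            gcongr
            rw [← ofReal_norm]
            exact ENNReal.ofReal_le_ofReal (hC y)
          · simp [hψK y hy]
      _ = ENNReal.ofReal C * ∫⁻ y in K, ‖f (wrap y)‖ₑ := by
          rw [lintegral_indicator hK, lintegral_const_mul'' _ hm.restrict.enorm]
      _ ≤ ENNReal.ofReal C * (c * ∫⁻ y in cellY N, ‖f (wrap y)‖ₑ) := by
          gcongr
          exact h _ (isYPeriodic_comp_wrap fun y => ‖f y‖ₑ) hm.enorm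
      _ = ENNReal.ofReal C * (c * eLpNorm f 1 (volume.restrict (cellY N))) := by
          rw [eLpNorm_one_eq_lintegral_enorm]
          congr 2
          exact lintegral_congr_ae (by filter_upwards [ae_cell_comp_wrap f] with y hy; rw [hy])
      _ ≤ ENNReal.ofReal C * (c * ‖f‖ₑ) := by
          rw [Lp.enorm_def]
          gcongr
          exact eLpNorm_le_eLpNorm_of_exponent_le (by norm_num) (Lp.aestronglyMeasurable f)
      _ = _ := by ring
  have hfin : ENNReal.ofReal C * c ≠ ⊤ := ENNReal.mul_ne_top ENNReal.ofReal_ne_top hc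
  have hint : ∀ f : Lp F 2 (volume.restrict (cellY N)), Integrable fun y => ψ y • f (wrap y) :=
    fun f => ⟨hψ.aestronglyMeasurable.smul
      (aestronglyMeasurable_comp_wrap (Lp.aestronglyMeasurable f)),
      (hbound f).trans_lt (ENNReal.mul_lt_top hfin.lt_top enorm_lt_top)⟩
  let L₀ : Lp F 2 (volume.restrict (cellY N)) →ₗ[ℝ] F :=
    { toFun := fun f => ∫ y, ψ y • f (wrap y)
      map_add' := fun f g => by
        rw [← integral_add (hint f) (hint g)]
        refine integral_congr_ae ?_
        filter_upwards [ae_wrap (Lp.coeFn_add f g)] with y hy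
        rw [hy, Pi.add_apply, smul_add]
      map_smul' := fun r f => by
        rw [RingHom.id_apply, ← integral_smul]
        refine integral_congr_ae ?_
        filter_upwards [ae_wrap (Lp.coeFn_smul r f)] with y hy
        rw [hy, Pi.smul_apply, smul_comm] }
  refine ⟨L₀.mkContinuous (ENNReal.ofReal C * c).toReal fun f => ?_, fun f => ⟨hint f, rfl⟩⟩
  have h1 := (enorm_integral_le_lintegral_enorm (fun y => ψ y • f (wrap y))).trans (hbound f)
  have h2 := ENNReal.toReal_mono (ENNReal.mul_ne_top hfin enorm_ne_top) h1
  rw [ENNReal.toReal_mul, toReal_enorm, toReal_enorm] at h2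
  exact h2

end Wrap

/-- A periodic extension is automatically periodic and locally square integrable; only the three
conditions that have to be shown closed remain. -/
theorem memVY_comp_wrap_iff (p : GraphSpace (cellY N)) :
    MemVY (fun y => p.fst (wrap y)) (fun y => p.snd (wrap y)) ↔
      (∀ φ : Vec N → ℝ, ContDiff ℝ ∞ φ → HasCompactSupport φ → ∀ k j : Fin N,
        ∫ y, p.fst (wrap y) k * fderiv ℝ φ y (EuclideanSpace.single j 1)
          = - ∫ y, p.snd (wrap y) (k, j) * φ y) ∧
      (∀ k, ∫ y in cellY N, p.fst (wrap y) k = 0) ∧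
      ∀ᵐ y ∂volume.restrict (cellY N), ∑ k, p.snd y (k, k) = 0 := by
  refine ⟨fun h => ⟨h.weak_grad, h.mean_zero, ?_⟩, fun h => ?_⟩
  · filter_upwards [ae_restrict_of_ae h.div_zero, ae_cell_comp_wrap p.snd] with y h1 h2
    rwa [h2] at h1
  · exact
      { memLp_loc := fun K hK => memLp_comp_wrap (Lp.memLp p.fst) hK.measurableSet hK.isBounded
        memLp_grad_loc := fun K hK => memLp_comp_wrap (Lp.memLp p.snd) hK.measurableSet hK.isBounded
        weak_grad := h.1
        periodic := isYPeriodic_comp_wrap _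
        mean_zero := h.2.1
        div_zero := ae_wrap h.2.2 }

/-- `V_Y`, realized as a space of pairs (field, gradient) on the cell. -/
def cellSpace (N : ℕ) : Submodule ℝ (GraphSpace (cellY N)) where
  carrier := {p | MemVY (fun y => p.fst (wrap y)) (fun y => p.snd (wrap y))}
  add_mem' {p q} hp hq := by
    refine (MemVY.add hp hq).congr ?_ ?_
    · filter_upwards [ae_wrap (Lp.coeFn_add p.fst q.fst)] with y hy
      exact hy.symm
    · filter_upwards [ae_wrap (Lp.coeFn_add p.snd q.snd)] with y hy
      exact hy.symm
  zero_mem' := by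
    refine MemVY.zero.congr ?_ ?_
    · filter_upwards [ae_wrap (Lp.coeFn_zero (Vec N) 2 (volume.restrict (cellY N)))] with y hy
      exact hy.symm
    · filter_upwards [ae_wrap (Lp.coeFn_zero (Mat N) 2 (volume.restrict (cellY N)))] with y hy
      exact hy.symm
  smul_mem' c p hp := by
    refine (MemVY.smul hp c).congr ?_ ?_
    · filter_upwards [ae_wrap (Lp.coeFn_smul c p.fst)] with y hy
      exact hy.symm
    · filter_upwards [ae_wrap (Lp.coeFn_smul c p.snd)] with y hy
      exact hy.symm

theorem continuous_fst_wrapPairing {ψ : Vec N → ℝ} (hψ : Measurable ψ) {C : ℝ}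
    (hC : ∀ y, ‖ψ y‖ ≤ C) {K : Set (Vec N)} (hK : MeasurableSet K) (hKb : Bornology.IsBounded K)
    (hψK : ∀ y, y ∉ K → ψ y = 0) (k : Fin N) :
    Continuous fun p : GraphSpace (cellY N) => ∫ y, p.fst (wrap y) k * ψ y := by
  obtain ⟨L, hL⟩ := exists_wrapPairing (F := Vec N) hψ hC hK hKb hψK
  have h : (fun p : GraphSpace (cellY N) => ∫ y, p.fst (wrap y) k * ψ y)
      = fun p : GraphSpace (cellY N) => (EuclideanSpace.proj k : Vec N →L[ℝ] ℝ)
          (L (WithLp.fstL 2 ℝ _ _ p)) := by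
    ext p
    rw [(hL _).2, ← ContinuousLinearMap.integral_comp_comm _ (hL _).1]
    refine integral_congr_ae (Eventually.of_forall fun y => ?_)
    simp [mul_comm]
  rw [h]
  fun_prop

theorem continuous_snd_wrapPairing {ψ : Vec N → ℝ} (hψ : Measurable ψ) {C : ℝ}
    (hC : ∀ y, ‖ψ y‖ ≤ C) {K : Set (Vec N)} (hK : MeasurableSet K) (hKb : Bornology.IsBounded K)
    (hψK : ∀ y, y ∉ K → ψ y = 0) (k : Fin N × Fin N) :
    Continuous fun p : GraphSpace (cellY N) => ∫ y, p.snd (wrap y) k * ψ y := by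
  obtain ⟨L, hL⟩ := exists_wrapPairing (F := Mat N) hψ hC hK hKb hψK
  have h : (fun p : GraphSpace (cellY N) => ∫ y, p.snd (wrap y) k * ψ y)
      = fun p : GraphSpace (cellY N) => (EuclideanSpace.proj k : Mat N →L[ℝ] ℝ)
          (L (WithLp.sndL 2 ℝ _ _ p)) := by
    ext p
    rw [(hL _).2, ← ContinuousLinearMap.integral_comp_comm _ (hL _).1]
    refine integral_congr_ae (Eventually.of_forall fun y => ?_)
    simp [mul_comm]
  rw [h]
  fun_prop

theorem isClosed_cellSpace : IsClosed (cellSpace N : Set (GraphSpace (cellY N))) := by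
  have h : (cellSpace N : Set (GraphSpace (cellY N))) = {p | _} :=
    Set.ext fun p => memVY_comp_wrap_iff p
  rw [h]
  refine IsClosed.inter (s₁ := {p | _}) (s₂ := {p | _}) ?_
    (IsClosed.inter (s₁ := {p | _}) (s₂ := {p | _}) ?_ ?_)
  · simp only [Set.ofPred_forall]
    refine isClosed_iInter fun φ => isClosed_iInter fun hφ => isClosed_iInter fun hφc =>
      isClosed_iInter fun k => isClosed_iInter fun j => ?_
    have hdc : Continuous fun y => fderiv ℝ φ y (EuclideanSpace.single j 1) :=
      (hφ.continuous_fderiv (by simp)).clm_apply continuous_const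
    have hdcs : HasCompactSupport fun y => fderiv ℝ φ y (EuclideanSpace.single j 1) :=
      hφc.fderiv_apply ℝ _
    obtain ⟨C, hC⟩ := hφ.continuous.bounded_above_of_compact_support hφc
    obtain ⟨C', hC'⟩ := hdc.bounded_above_of_compact_support hdcs
    exact isClosed_eq
      (continuous_fst_wrapPairing hdc.measurable hC' hdcs.isCompact.measurableSet
        hdcs.isCompact.isBounded (fun y hy => image_eq_zero_of_notMem_tsupport
          (f := fun y => fderiv ℝ φ y (EuclideanSpace.single j 1)) hy) k)
      (continuous_snd_wrapPairing hφ.continuous.measurable hC hφc.isCompact.measurableSet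
        hφc.isCompact.isBounded (fun y hy => image_eq_zero_of_notMem_tsupport hy) (k, j)).neg
  · simp only [Set.ofPred_forall]
    refine isClosed_iInter fun k => ?_
    -- The mean over the cell is a pairing with the indicator of the cell, so its continuity is a
    -- case of the pairing lemma.
    have h1 : ∀ p : GraphSpace (cellY N), ∫ y in cellY N, p.fst (wrap y) k
        = ∫ y, p.fst (wrap y) k * (cellY N).indicator 1 y := fun p => by
      rw [← integral_indicator measurableSet_cellY]
      refine integral_congr_ae (Eventually.of_forall fun y => ?_)
      by_cases hy : y ∈ cellY N <;> simp [hy]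
    simp only [h1]
    refine isClosed_eq (continuous_fst_wrapPairing
      (measurable_one.indicator measurableSet_cellY) (C := 1) (fun y => ?_) measurableSet_cellY
      ?_ (fun y hy => indicator_of_notMem hy _) k) continuous_const
    · by_cases hy : y ∈ cellY N <;> simp [hy]
    · exact (Metric.isBounded_closedBall (x := (0 : Vec N)) (r := Real.sqrt N)).subset
        fun y hy => by simpa using norm_le_of_mem_cellY hy
  -- The divergence condition is the kernel of the trace, lifted to a continuous operator on `L²`.
  · let tr : Mat N →L[ℝ] ℝ := ∑ k, EuclideanSpace.proj (k, k)
    have h1 : {p : GraphSpace (cellY N) |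
        ∀ᵐ y ∂volume.restrict (cellY N), ∑ k, p.snd y (k, k) = 0}
        = {p | tr.compLpL 2 (volume.restrict (cellY N)) (WithLp.sndL 2 ℝ _ _ p) = 0} := by
      ext p
      rw [mem_ofPred_eq, mem_ofPred_eq, Lp.eq_zero_iff_ae_eq_zero]
      have h2 := tr.coeFn_compLpL (p := 2) (μ := volume.restrict (cellY N)) p.snd
      refine ⟨fun h => ?_, fun h => ?_⟩
      · filter_upwards [h, h2] with y h3 h4
        refine h4.trans ?_
        simpa [tr] using h3
      · filter_upwards [h, h2] with y h3 h4
        have h5 := h4.symm.trans h3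
        simpa [tr] using h5
    exact h1 ▸ isClosed_eq (by fun_prop) continuous_const

/-- Restricting to the cell and extending again loses nothing, since both the field and its gradient
are periodic. -/
theorem MemVY.exists_mem_cellSpace {w : Vec N → Vec N} {Dw : Vec N → Mat N} (hw : MemVY w Dw) :
    ∃ q ∈ cellSpace N, q.snd =ᵐ[volume.restrict (cellY N)] Dw := by
  refine ⟨WithLp.toLp 2 (hw.memLp_cell.toLp w, hw.memLp_grad_cell.toLp Dw), ?_,
    hw.memLp_grad_cell.coeFn_toLp⟩
  refine hw.congr ?_ ?_
  · filter_upwards [ae_wrap hw.memLp_cell.coeFn_toLp, hw.periodic.ae_eq_wrap] with y h1 h2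
    exact (h1.trans h2).symm
  · filter_upwards [ae_wrap hw.memLp_grad_cell.coeFn_toLp, hw.grad_periodic.ae_eq_wrap] with y h1 h2
    exact (h1.trans h2).symm

/-! ### Existence for the cell problem by Lax-Milgram. -/

theorem Lp_norm_sq_eq_integral {α F : Type*} [MeasurableSpace α] {μ : Measure α}
    [NormedAddCommGroup F] [InnerProductSpace ℝ F] (f : Lp F 2 μ) :
    ‖f‖ ^ 2 = ∫ x, ‖f x‖ ^ 2 ∂μ := by
  rw [← real_inner_self_eq_norm_sq, L2.inner_def]
  simp only [real_inner_self_eq_norm_sq]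

theorem Lp_enorm_sq_eq_lintegral {α F : Type*} [MeasurableSpace α] {μ : Measure α}
    [NormedAddCommGroup F] (f : Lp F 2 μ) : ‖f‖ₑ ^ 2 = ∫⁻ x, ‖f x‖ₑ ^ 2 ∂μ := by
  have h := eLpNorm_nnreal_pow_eq_lintegral (f := f) (μ := μ) (p := 2) (by norm_num)
  rw [Lp.enorm_def]
  simpa using h

theorem quasiMeasurePreserving_id_cellY :
    Measure.QuasiMeasurePreserving (id : Vec N → Vec N) (volume.restrict (cellY N)) volume :=
  (Measure.QuasiMeasurePreserving.id volume).mono_left Measure.absolutelyContinuous_restrict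

theorem IsAdmissible.exists_bilin {a : Fin N → Fin N → Vec N → ℝ} (ha : IsAdmissible a) :
    ∃ B : Lp (Mat N) 2 (volume.restrict (cellY N)) →L[ℝ]
        Lp (Mat N) 2 (volume.restrict (cellY N)) →L[ℝ] ℝ,
      ∀ G H, B G H = ∫ y in cellY N, form a y (G y) (H y) := by
  obtain ⟨M, hM0, hM⟩ := ha.exists_form_bound
  have hint : ∀ G H : Lp (Mat N) 2 (volume.restrict (cellY N)),
      Integrable (fun y => form a y (G y) (H y)) (volume.restrict (cellY N)) := fun G H =>
    ha.integrable_form quasiMeasurePreserving_id_cellY (Lp.memLp G) (Lp.memLp H)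
  let B₀ := LinearMap.mk₂ ℝ
    (fun G H : Lp (Mat N) 2 (volume.restrict (cellY N)) => ∫ y in cellY N, form a y (G y) (H y))
    (fun G G' H => by
      rw [← integral_add (hint G H) (hint G' H)]
      refine integral_congr_ae ?_
      filter_upwards [Lp.coeFn_add G G'] with y hy
      rw [hy, Pi.add_apply, form_add_left])
    (fun c G H => by
      rw [smul_eq_mul, ← integral_const_mul]
      refine integral_congr_ae ?_
      filter_upwards [Lp.coeFn_smul c G] with y hy
      rw [hy, Pi.smul_apply, form_smul_left])
    (fun G H H' => by
      rw [← integral_add (hint G H) (hint G H')]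
      refine integral_congr_ae ?_
      filter_upwards [Lp.coeFn_add H H'] with y hy
      rw [hy, Pi.add_apply, form_add_right])
    (fun c G H => by
      rw [smul_eq_mul, ← integral_const_mul]
      refine integral_congr_ae ?_
      filter_upwards [Lp.coeFn_smul c H] with y hy
      rw [hy, Pi.smul_apply, form_smul_right])
  refine ⟨B₀.mkContinuous₂ M fun G H => ?_, fun G H => rfl⟩
  have h1 : ‖∫ y in cellY N, form a y (G y) (H y)‖ₑ ≤ ENNReal.ofReal M * (‖G‖ₑ * ‖H‖ₑ) := by
    have h2 := eLpNorm_le_eLpNorm_mul_eLpNorm_of_nnnorm (p := 2) (q := 2) (r := 1)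
      (Lp.aestronglyMeasurable G) (Lp.aestronglyMeasurable H)
      (fun u v => ‖u‖ * ‖v‖) 1 (Eventually.of_forall fun y => by simp)
    rw [eLpNorm_one_eq_lintegral_enorm] at h2
    calc ‖∫ y in cellY N, form a y (G y) (H y)‖ₑ
        ≤ ∫⁻ y in cellY N, ‖form a y (G y) (H y)‖ₑ := enorm_integral_le_lintegral_enorm _
      _ ≤ ∫⁻ y in cellY N, ENNReal.ofReal M * ‖‖G y‖ * ‖H y‖‖ₑ := by
          refine lintegral_mono_ae ?_
          filter_upwards [ae_restrict_of_ae hM] with y hy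
          have h3 : ‖‖G y‖ * ‖H y‖‖ₑ = ENNReal.ofReal (‖G y‖ * ‖H y‖) :=
            Real.enorm_of_nonneg (by positivity)
          rw [h3, ← ENNReal.ofReal_mul hM0, ← ofReal_norm]
          exact ENNReal.ofReal_le_ofReal (hy _ _)
      _ = ENNReal.ofReal M * ∫⁻ y in cellY N, ‖‖G y‖ * ‖H y‖‖ₑ :=
          lintegral_const_mul' _ _ ENNReal.ofReal_ne_top
      _ ≤ _ := by
          gcongr
          simpa [Lp.enorm_def] using h2
  have h3 := ENNReal.toReal_mono (by finiteness) h1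
  rw [ENNReal.toReal_mul, ENNReal.toReal_mul, toReal_enorm, toReal_enorm, toReal_enorm,
    ENNReal.toReal_ofReal hM0, ← mul_assoc] at h3
  exact h3

theorem exists_norm_fst_sq_le (N : ℕ) : ∃ C : ℝ, 0 ≤ C ∧
    ∀ q ∈ cellSpace N, ‖q.fst‖ ^ 2 ≤ C * ‖q.snd‖ ^ 2 := by
  obtain ⟨C, hC, h⟩ := exists_poincare N
  refine ⟨C.toReal, ENNReal.toReal_nonneg, fun q hq => ?_⟩
  have h1 := h _ _ hq
  have h2 : ‖q.fst‖ₑ ^ 2 ≤ C * ‖q.snd‖ₑ ^ 2 := by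
    rw [Lp_enorm_sq_eq_lintegral, Lp_enorm_sq_eq_lintegral]
    refine (le_of_eq ?_).trans (h1.trans (le_of_eq ?_))
    · refine lintegral_congr_ae ?_
      filter_upwards [ae_cell_comp_wrap q.fst] with y hy
      rw [hy]
    · congr 1
      refine lintegral_congr_ae ?_
      filter_upwards [ae_cell_comp_wrap q.snd] with y hy
      rw [hy]
  have h3 := ENNReal.toReal_mono (by finiteness) h2
  simpa only [ENNReal.toReal_mul, ENNReal.toReal_pow, toReal_enorm] using h3

/-- The Lax-Milgram theorem for a coercive form pulled back by a bounded-below map. -/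
theorem exists_eq_of_coercive_comp {V W : Type*} [NormedAddCommGroup V] [InnerProductSpace ℝ V]
    [CompleteSpace V] [NormedAddCommGroup W] [NormedSpace ℝ W] (B : W →L[ℝ] W →L[ℝ] ℝ)
    (S : V →L[ℝ] W) {α C : ℝ} (hα : 0 < α) (hC : 0 < C) (hB : ∀ G, α * ‖G‖ ^ 2 ≤ B G G)
    (hS : ∀ u, ‖u‖ ^ 2 ≤ C * ‖S u‖ ^ 2) (ℓ : W →L[ℝ] ℝ) : ∃ u, ∀ q, B (S u) (S q) = ℓ (S q) := by
  have hA : IsCoercive (B.bilinearComp S S) := by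
    refine ⟨α / C, by positivity, fun u => ?_⟩
    calc α / C * ‖u‖ * ‖u‖ = α / C * ‖u‖ ^ 2 := by ring
      _ ≤ α / C * (C * ‖S u‖ ^ 2) := by gcongr; exact hS u
      _ = α * ‖S u‖ ^ 2 := by field_simp
      _ ≤ B (S u) (S u) := hB _
  refine ⟨hA.continuousLinearEquivOfBilin.symm ((InnerProductSpace.toDual ℝ V).symm (ℓ.comp S)),
    fun q => ?_⟩
  have h := hA.continuousLinearEquivOfBilin_apply
    (hA.continuousLinearEquivOfBilin.symm ((InnerProductSpace.toDual ℝ V).symm (ℓ.comp S))) q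
  rw [ContinuousLinearEquiv.apply_symm_apply, InnerProductSpace.toDual_symm_apply] at h
  exact h.symm

theorem exists_sndL_cellSpace (N : ℕ) :
    ∃ S : cellSpace N →L[ℝ] Lp (Mat N) 2 (volume.restrict (cellY N)),
      ∀ u, S u = (u : GraphSpace (cellY N)).snd :=
  ⟨(WithLp.sndL 2 ℝ _ _).comp (cellSpace N).subtypeL, fun _ => rfl⟩

theorem exists_norm_sq_le_cellSpace (N : ℕ) : ∃ C : ℝ, 0 < C ∧
    ∀ u : cellSpace N, ‖u‖ ^ 2 ≤ C * ‖(u : GraphSpace (cellY N)).snd‖ ^ 2 := by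
  obtain ⟨C, hC0, hC⟩ := exists_norm_fst_sq_le N
  -- The squared graph norm is the sum of the squared norms of field and gradient; Poincaré bounds
  -- the first by `C` times the second.
  refine ⟨C + 1, by positivity, fun u => ?_⟩
  rw [Submodule.norm_coe u |>.symm, WithLp.prod_norm_sq_eq_of_L2]
  linarith [hC u u.2]

theorem IsAdmissible.exists_lp_coercive {a : Fin N → Fin N → Vec N → ℝ} (ha : IsAdmissible a) :
    ∃ α : ℝ, 0 < α ∧ ∀ G : Lp (Mat N) 2 (volume.restrict (cellY N)),
      α * ‖G‖ ^ 2 ≤ ∫ y in cellY N, form a y (G y) (G y) := by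
  obtain ⟨α, hα, hαc⟩ := ha.exists_form_coercive
  refine ⟨α, hα, fun G => ?_⟩
  rw [Lp_norm_sq_eq_integral, ← integral_const_mul]
  refine integral_mono_ae ?_ ?_ ?_
  · exact ((Lp.memLp G).integrable_norm_pow (by norm_num)).const_mul α
  · exact ha.integrable_form quasiMeasurePreserving_id_cellY (Lp.memLp _) (Lp.memLp _)
  · filter_upwards [ae_restrict_of_ae hαc] with y hy
    exact hy _

/-- The stationary cell problem with datum a constant gradient `E`. -/
theorem IsAdmissible.exists_stationary_solution {a : Fin N → Fin N → Vec N → ℝ}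
    (ha : IsAdmissible a) (E : Mat N) :
    ∃ u ∈ cellSpace N, ∀ q ∈ cellSpace N,
      ∫ y in cellY N, form a y (u.snd y) (q.snd y) = ∫ y in cellY N, form a y E (q.snd y) := by
  obtain ⟨B, hB⟩ := ha.exists_bilin
  obtain ⟨C, hC0, hC⟩ := exists_norm_sq_le_cellSpace N
  obtain ⟨α, hα, hαc⟩ := ha.exists_lp_coercive
  obtain ⟨S, hS⟩ := exists_sndL_cellSpace N
  have hE : MemLp (fun _ => E) 2 (volume.restrict (cellY N)) := memLp_const E
  have : CompleteSpace (cellSpace N) := isClosed_cellSpace.completeSpace_coe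
  obtain ⟨u, hu⟩ := exists_eq_of_coercive_comp B S hα hC0 (fun G => by rw [hB]; exact hαc G)
    (fun u => by rw [hS]; exact hC u) (B (hE.toLp _))
  refine ⟨u, u.2, fun q hq => ?_⟩
  have h := hu ⟨q, hq⟩
  rw [hB, hB, hS, hS] at h
  refine h.trans (integral_congr_ae ?_)
  filter_upwards [hE.coeFn_toLp] with y hy
  rw [hy]

theorem MemLp.comp_fst_cellYZ {F : Type*} [NormedAddCommGroup F] {f : Vec N → F}
    (hf : MemLp f 2 (volume.restrict (cellY N))) :
    MemLp (fun p : Vec N × ℝ => f p.1) 2 (volume.restrict (cellYZ N)) := by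
  rw [restrict_cellYZ]
  exact hf.comp_measurePreserving measurePreserving_fst

/-- A field of `V_Y`, as a field of `L²_per(Z; V_Y)` independent of `τ`. -/
def L2PerVY.ofStationary {w : Vec N → Vec N} {Dw : Vec N → Mat N} (hw : MemVY w Dw) :
    L2PerVY N where
  toFun p := w p.1
  grad p := Dw p.1
  mem :=
    { aesm := hw.locallyIntegrable.aestronglyMeasurable.comp_quasiMeasurePreserving
        Measure.quasiMeasurePreserving_fst
      aesm_grad := hw.locallyIntegrable_grad.aestronglyMeasurable.comp_quasiMeasurePreserving
        Measure.quasiMeasurePreserving_fst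
      slice := Eventually.of_forall fun _ => hw
      periodic := fun _ => Eventually.of_forall fun _ => rfl
      memLp := MemLp.comp_fst_cellYZ hw.memLp_cell
      memLp_grad := MemLp.comp_fst_cellYZ hw.memLp_grad_cell }

/-- The coefficients and the datum do not depend on `τ`, so the stationary solution suffices: its
equation holds against almost every `τ`-slice of a test field and is integrated over `Z`. -/
theorem IsAdmissible.exists_cellSolution {a : Fin N → Fin N → Vec N → ℝ}
    (ha : IsAdmissible a) (i k : Fin N) : ∃ χ : L2PerVY N, IsCellSolution a i k χ := by
  obtain ⟨u, hu, h⟩ := ha.exists_stationary_solution (EuclideanSpace.single (k, i) 1)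
  have hu' : MemVY (fun y => u.fst (wrap y)) (fun y => u.snd (wrap y)) := hu
  refine ⟨L2PerVY.ofStationary hu', (isCellSolution_iff ha).2 fun w => ?_⟩
  have i1 := ha.integrable_form quasiMeasurePreserving_fst_cellYZ
    (L2PerVY.ofStationary hu').mem.memLp_grad w.mem.memLp_grad
  have i2 := ha.integrable_form quasiMeasurePreserving_fst_cellYZ
    (memLp_const (EuclideanSpace.single (k, i) (1 : ℝ))) w.mem.memLp_grad
  rw [restrict_cellYZ] at i1 i2 ⊢
  rw [integral_prod_symm _ i1, integral_prod_symm _ i2]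
  refine integral_congr_ae ?_
  filter_upwards [ae_restrict_of_ae w.mem.slice] with τ hτ
  obtain ⟨q, hq, hqw⟩ := hτ.exists_mem_cellSpace
  refine Eq.trans (integral_congr_ae ?_) ((h q hq).trans (integral_congr_ae ?_))
  · filter_upwards [hqw, ae_cell_comp_wrap u.snd] with y h1 h2
    rw [h1]
    change form a y (u.snd (wrap y)) _ = _
    rw [h2]
  · filter_upwards [hqw] with y h1
    rw [h1]

/-! ### Linear combinations in `L²_per(Z; V_Y)` and uniqueness of the cell solution. -/

namespace MemL2PerVY

variable {w w' : Vec N × ℝ → Vec N} {Dw Dw' : Vec N × ℝ → Mat N}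

theorem zero : MemL2PerVY (N := N) (fun _ => 0) (fun _ => 0) where
  aesm := aestronglyMeasurable_const
  aesm_grad := aestronglyMeasurable_const
  slice := Eventually.of_forall fun _ => MemVY.zero
  periodic _ := Eventually.of_forall fun _ => rfl
  memLp := MemLp.zero'
  memLp_grad := MemLp.zero'

theorem add (hw : MemL2PerVY w Dw) (hw' : MemL2PerVY w' Dw') :
    MemL2PerVY (fun p => w p + w' p) (fun p => Dw p + Dw' p) where
  aesm := hw.aesm.add hw'.aesm
  aesm_grad := hw.aesm_grad.add hw'.aesm_grad
  slice := by
    filter_upwards [hw.slice, hw'.slice] with τ h1 h2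
    exact h1.add h2
  periodic m := by
    filter_upwards [hw.periodic m, hw'.periodic m] with p h1 h2
    rw [h1, h2]
  memLp := hw.memLp.add hw'.memLp
  memLp_grad := hw.memLp_grad.add hw'.memLp_grad

theorem smul (hw : MemL2PerVY w Dw) (c : ℝ) :
    MemL2PerVY (fun p => c • w p) (fun p => c • Dw p) where
  aesm := hw.aesm.const_smul c
  aesm_grad := hw.aesm_grad.const_smul c
  slice := by
    filter_upwards [hw.slice] with τ h1
    exact h1.smul c
  periodic m := by
    filter_upwards [hw.periodic m] with p h1
    rw [h1]
  memLp := hw.memLp.const_smul c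
  memLp_grad := hw.memLp_grad.const_smul c

theorem sum_smul {ι : Type*} (s : Finset ι) (c : ι → ℝ) (χ : ι → L2PerVY N) :
    MemL2PerVY (fun p => ∑ i ∈ s, c i • (χ i).toFun p) (fun p => ∑ i ∈ s, c i • (χ i).grad p) := by
  classical
  induction s using Finset.induction_on with
  | empty => simpa using zero
  | insert i s hi ih =>
    simp only [Finset.sum_insert hi]
    exact ((χ i).mem.smul (c i)).add ih

end MemL2PerVY

/-- The solution of the cell problem is unique. -/
theorem IsCellSolution.ae_eq {a : Fin N → Fin N → Vec N → ℝ} (ha : IsAdmissible a) {i k : Fin N}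
    {χ χ' : L2PerVY N} (h : IsCellSolution a i k χ) (h' : IsCellSolution a i k χ') :
    χ'.toFun =ᵐ[volume] χ.toFun := by
  -- The difference `χ' - χ` is itself a test field; tested with it, the two equations give zero
  -- energy.
  have hd := χ'.mem.add (χ.mem.smul (-1))
  rw [isCellSolution_iff ha] at h h'
  have e1 := (h' ⟨_, _, hd⟩).trans (h ⟨_, _, hd⟩).symm
  have i1 := ha.integrable_form quasiMeasurePreserving_fst_cellYZ χ'.mem.memLp_grad hd.memLp_grad
  have i2 := ha.integrable_form quasiMeasurePreserving_fst_cellYZ χ.mem.memLp_grad hd.memLp_grad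
  have h0 := hd.ae_eq_zero (ha.ae_eq_zero_of_integral_form_eq_zero
    quasiMeasurePreserving_fst_cellYZ hd.memLp_grad (by
      simp only [form_add_left, form_smul_left _ _ (-1)]
      rw [integral_add i1 (i2.const_mul _), integral_const_mul, e1]
      ring))
  filter_upwards [h0] with p hp
  rwa [neg_one_smul, ← sub_eq_add_neg, sub_eq_zero] at hp

/-! ### The corrector formula on `Q × Y × Z`. -/

theorem memLp_prod_smul {α β F : Type*} [MeasurableSpace α] [MeasurableSpace β] {μ : Measure α}
    {ν : Measure β} [SFinite μ] [SFinite ν] [NormedAddCommGroup F] [NormedSpace ℝ F]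
    {r : α → ℝ} {f : β → F} (hr : MemLp r 2 μ) (hf : MemLp f 2 ν) :
    MemLp (fun z : α × β => r z.1 • f z.2) 2 (μ.prod ν) := by
  have hm : AEStronglyMeasurable (fun z : α × β => r z.1 • f z.2) (μ.prod ν) :=
    hr.aestronglyMeasurable.comp_fst.smul hf.aestronglyMeasurable.comp_snd
  rw [memLp_two_iff_integrable_sq_norm hm]
  have h1 := ((memLp_two_iff_integrable_sq_norm hr.aestronglyMeasurable).1 hr).mul_prod
    ((memLp_two_iff_integrable_sq_norm hf.aestronglyMeasurable).1 hf)
  refine h1.congr (Eventually.of_forall fun z => ?_)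
  simp only [norm_smul, mul_pow]

section Cylinder

variable {Ω : Set (Vec N)} {T : ℝ}

theorem restrict_cyl : (volume.restrict (cyl Ω T) : Measure (Vec N × ℝ))
    = (volume.restrict Ω).prod (volume.restrict (Ioo 0 T)) := by
  rw [Measure.prod_restrict]; rfl

theorem restrict_cyl_prod_cellYZ :
    (volume.restrict (cyl Ω T ×ˢ cellYZ N) : Measure ((Vec N × ℝ) × (Vec N × ℝ)))
      = (volume.restrict (cyl Ω T)).prod (volume.restrict (cellYZ N)) := by
  rw [Measure.prod_restrict]; rfl

theorem quasiMeasurePreserving_cyl_prod_cellYZ :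
    Measure.QuasiMeasurePreserving (fun z : (Vec N × ℝ) × (Vec N × ℝ) => z.2.1)
      ((volume.restrict (cyl Ω T)).prod (volume.restrict (cellYZ N))) volume :=
  quasiMeasurePreserving_fst_cellYZ.comp Measure.quasiMeasurePreserving_snd

theorem L2V.memLp_grad_prod (u : L2V Ω T) :
    MemLp (fun z : (Vec N × ℝ) × (Vec N × ℝ) => u.grad z.1) 2
      ((volume.restrict (cyl Ω T)).prod (volume.restrict (cellYZ N))) :=
  u.memLp_grad.comp_measurePreserving measurePreserving_fst

theorem L2QPerVY.memLp_grad_prod (u : L2QPerVY Ω T) :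
    MemLp u.grad 2 ((volume.restrict (cyl Ω T)).prod (volume.restrict (cellYZ N))) := by
  rw [← restrict_cyl_prod_cellYZ]
  exact u.memLp_grad

/-- The zero element of `L²(0, T; V)`. -/
noncomputable def L2V.zero (Ω : Set (Vec N)) (T : ℝ) : L2V Ω T where
  toFun _ := 0
  grad _ := 0
  path _ := 0
  memLp_toFun := MemLp.zero'
  memLp_grad := MemLp.zero'
  memLp_path := MemLp.zero'
  path_fst := Eventually.of_forall fun _ => Lp.coeFn_zero _ _ _
  path_snd := Eventually.of_forall fun _ => Lp.coeFn_zero _ _ _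

/-- Fubini, applied to each term of the sum, merges the iterated integrals over `t`, `x` and `(y,
τ)` into one integral, to which the coercivity argument applies. -/
theorem integral_aHatOmega {a : Fin N → Fin N → Vec N → ℝ} (ha : IsAdmissible a)
    (u0 : L2V Ω T) (u1 v1 : L2QPerVY Ω T) :
    ∫ t in Ioo 0 T, aHatOmega a Ω (fun x => u0.grad (x, t)) (fun x p => u1.grad ((x, t), p))
        (fun _ => 0) (fun x p => v1.grad ((x, t), p))
      = ∫ z, form a z.2.1 (u0.grad z.1 + u1.grad z) (v1.grad z)
          ∂(volume.restrict (cyl Ω T)).prod (volume.restrict (cellYZ N)) := by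
  have hG : MemLp (fun z => u0.grad z.1 + u1.grad z) 2
      ((volume.restrict (cyl Ω T)).prod (volume.restrict (cellYZ N))) :=
    u0.memLp_grad_prod.add u1.memLp_grad_prod
  have hF := ha.integrable_form_term quasiMeasurePreserving_cyl_prod_cellYZ hG v1.memLp_grad_prod
  rw [ha.integral_form quasiMeasurePreserving_cyl_prod_cellYZ hG v1.memLp_grad_prod]
  have hq : ∀ i j k, Integrable (fun q : Vec N × ℝ => ∫ p in cellYZ N,
      a i j p.1 * (u0.grad q (k, j) + u1.grad (q, p) (k, j)) * v1.grad (q, p) (k, i))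
      ((volume.restrict Ω).prod (volume.restrict (Ioo 0 T))) := fun i j k => by
    rw [← restrict_cyl]
    exact (hF i j k).integral_prod_left
  have ht : ∀ i j k, Integrable (fun t => ∫ x in Ω, ∫ p in cellYZ N,
      a i j p.1 * (u0.grad (x, t) (k, j) + u1.grad ((x, t), p) (k, j)) * v1.grad ((x, t), p) (k, i))
      (volume.restrict (Ioo 0 T)) := fun i j k => (hq i j k).integral_prod_right
  unfold aHatOmega
  simp only [PiLp.zero_apply, zero_add]
  rw [integral_finsetSum _ fun i _ => integrable_finsetSum _ fun j _ =>
    integrable_finsetSum _ fun k _ => ht i j k]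
  refine Finset.sum_congr rfl fun i _ => ?_
  rw [integral_finsetSum _ fun j _ => integrable_finsetSum _ fun k _ => ht i j k]
  refine Finset.sum_congr rfl fun j _ => ?_
  rw [integral_finsetSum _ fun k _ => ht i j k]
  refine Finset.sum_congr rfl fun k _ => ?_
  rw [integral_prod _ (hF i j k), restrict_cyl, ← integral_prod_symm _ (hq i j k)]
  rfl

/-- The local equation: the homogenized problem tested with `v_0 = 0`. -/
theorem IsGlobalSolution.integral_form_eq_zero {a : Fin N → Fin N → Vec N → ℝ}
    (ha : IsAdmissible a) {f : ℝ → StrongDual ℝ (V Ω)} {u0 : L2V Ω T} {u1 : L2QPerVY Ω T}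
    (hu : IsGlobalSolution a f u0 u1) (v1 : L2QPerVY Ω T) :
    ∫ z, form a z.2.1 (u0.grad z.1 + u1.grad z) (v1.grad z)
      ∂(volume.restrict (cyl Ω T)).prod (volume.restrict (cellYZ N)) = 0 := by
  obtain ⟨-, g, -, h⟩ := hu
  have h1 := h (L2V.zero Ω T) v1
  simp only [L2V.zero, map_zero, integral_zero, zero_add] at h1
  rw [← integral_aHatOmega ha u0 u1 v1]
  exact h1

/-- The corrector defect `u_1 + ∑ ∂u_0^k/∂x_i χ_ik`. -/
noncomputable def L2QPerVY.defect (u0 : L2V Ω T) (u1 : L2QPerVY Ω T) (χ : Fin N × Fin N → L2PerVY N) :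
    L2QPerVY Ω T where
  toFun z := u1.toFun z + ∑ c : Fin N × Fin N, u0.grad z.1 (c.2, c.1) • (χ c).toFun z.2
  grad z := u1.grad z + ∑ c : Fin N × Fin N, u0.grad z.1 (c.2, c.1) • (χ c).grad z.2
  aesm := u1.aesm.add <| Finset.aestronglyMeasurable_fun_sum _ fun c _ =>
    ((EuclideanSpace.proj (c.2, c.1) : Mat N →L[ℝ] ℝ).comp_memLp'
      u0.memLp_grad).aestronglyMeasurable.comp_fst.smul (χ c).mem.aesm.comp_snd
  aesm_grad := u1.aesm_grad.add <| Finset.aestronglyMeasurable_fun_sum _ fun c _ =>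
    ((EuclideanSpace.proj (c.2, c.1) : Mat N →L[ℝ] ℝ).comp_memLp'
      u0.memLp_grad).aestronglyMeasurable.comp_fst.smul (χ c).mem.aesm_grad.comp_snd
  -- For fixed `(x, t)` the entries of `∇u_0` are constants, so the added term is a finite linear
  -- combination of cell solutions.
  slice := by
    filter_upwards [u1.slice] with q hq
    exact hq.add (MemL2PerVY.sum_smul _ _ _)
  memLp := u1.memLp.add <| memLp_finsetSum _ fun c _ => by
    rw [restrict_cyl_prod_cellYZ]
    exact memLp_prod_smul ((EuclideanSpace.proj (c.2, c.1) : Mat N →L[ℝ] ℝ).comp_memLp'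
      u0.memLp_grad) (χ c).mem.memLp
  memLp_grad := u1.memLp_grad.add <| memLp_finsetSum _ fun c _ => by
    rw [restrict_cyl_prod_cellYZ]
    exact memLp_prod_smul ((EuclideanSpace.proj (c.2, c.1) : Mat N →L[ℝ] ℝ).comp_memLp'
      u0.memLp_grad) (χ c).mem.memLp_grad

/-- The index `c = (i, k)` follows the cell problems, whereas gradient entries are indexed by `(k,
i)`; hence the swap. -/
theorem mat_eq_sum_single (G : Mat N) :
    G = ∑ c : Fin N × Fin N, G (c.2, c.1) • EuclideanSpace.single (c.2, c.1) (1 : ℝ) := by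
  ext p
  rw [WithLp.ofLp_sum, Finset.sum_apply, Finset.sum_eq_single (p.2, p.1)]
  · simp
  · intro c _ hc
    have : p ≠ (c.2, c.1) := fun h => hc (by rw [h])
    simp [this]
  · simp

/-- Expanding `G` in elementary matrices gives a linear combination of the cell equations. -/
theorem integral_form_corrector_eq_zero {a : Fin N → Fin N → Vec N → ℝ} (ha : IsAdmissible a)
    {χ : Fin N × Fin N → L2PerVY N} (hχ : ∀ c, IsCellSolution a c.1 c.2 (χ c)) (G : Mat N)
    (w : L2PerVY N) :
    ∫ p in cellYZ N, form a p.1 (G - ∑ c : Fin N × Fin N, G (c.2, c.1) • (χ c).grad p)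
      (w.grad p) = 0 := by
  have e : ∀ p, G - ∑ c : Fin N × Fin N, G (c.2, c.1) • (χ c).grad p
      = ∑ c : Fin N × Fin N, G (c.2, c.1) •
        (EuclideanSpace.single (c.2, c.1) (1 : ℝ) - (χ c).grad p) := fun p => by
    conv_lhs => rw [mat_eq_sum_single G]
    simp only [smul_sub, Finset.sum_sub_distrib]
    rw [← mat_eq_sum_single G]
  have i1 : ∀ c : Fin N × Fin N, Integrable (fun p : Vec N × ℝ =>
      form a p.1 (EuclideanSpace.single (c.2, c.1) (1 : ℝ)) (w.grad p))
      (volume.restrict (cellYZ N)) := fun c =>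
    ha.integrable_form quasiMeasurePreserving_fst_cellYZ (memLp_const _) w.mem.memLp_grad
  have i2 : ∀ c : Fin N × Fin N, Integrable (fun p : Vec N × ℝ =>
      form a p.1 ((χ c).grad p) (w.grad p)) (volume.restrict (cellYZ N)) := fun c =>
    ha.integrable_form quasiMeasurePreserving_fst_cellYZ (χ c).mem.memLp_grad w.mem.memLp_grad
  simp only [e, form_sum_left, form_smul_left, form_sub_left]
  refine (integral_finsetSum _ fun c _ => ((i1 c).sub (i2 c)).const_mul _).trans
    (Finset.sum_eq_zero fun c _ => ?_)
  simp only [Pi.sub_apply]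
  rw [integral_const_mul, integral_sub (i1 c) (i2 c), (isCellSolution_iff ha).1 (hχ c) w,
    sub_self, mul_zero]

/-- The defect serves as test field in the homogenized equation and, slice by slice, in the cell
equations. Subtracting gives zero energy for its own gradient. -/
theorem IsGlobalSolution.grad_defect_ae_eq_zero {a : Fin N → Fin N → Vec N → ℝ}
    (ha : IsAdmissible a) {f : ℝ → StrongDual ℝ (V Ω)} {u0 : L2V Ω T} {u1 : L2QPerVY Ω T}
    (hu : IsGlobalSolution a f u0 u1) {χ : Fin N × Fin N → L2PerVY N}
    (hχ : ∀ c, IsCellSolution a c.1 c.2 (χ c)) :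
    ∀ᵐ z ∂(volume.restrict (cyl Ω T)).prod (volume.restrict (cellYZ N)),
      (L2QPerVY.defect u0 u1 χ).grad z = 0 := by
  set d := L2QPerVY.defect u0 u1 χ with hd
  refine ha.ae_eq_zero_of_integral_form_eq_zero quasiMeasurePreserving_cyl_prod_cellYZ
    d.memLp_grad_prod ?_
  -- The subtracted bracket equals `∇u_0 - ∑ ∂u_0^k/∂x_i ∇_y χ_ik`, which is energy-orthogonal to
  -- admissible gradients for each fixed `(x, t)`.
  have hdg : ∀ z, d.grad z
      = (u0.grad z.1 + u1.grad z) - (u0.grad z.1 + u1.grad z - d.grad z) := fun z => by abel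
  have hG : MemLp (fun z => u0.grad z.1 + u1.grad z) 2
      ((volume.restrict (cyl Ω T)).prod (volume.restrict (cellYZ N))) :=
    u0.memLp_grad_prod.add u1.memLp_grad_prod
  have i1 := ha.integrable_form quasiMeasurePreserving_cyl_prod_cellYZ hG d.memLp_grad_prod
  have hG' : MemLp (fun z => u0.grad z.1 + u1.grad z - d.grad z) 2
      ((volume.restrict (cyl Ω T)).prod (volume.restrict (cellYZ N))) :=
    hG.sub d.memLp_grad_prod
  have i2 := ha.integrable_form quasiMeasurePreserving_cyl_prod_cellYZ hG' d.memLp_grad_prod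
  have h2 : ∫ z, form a z.2.1 (u0.grad z.1 + u1.grad z - d.grad z) (d.grad z)
      ∂(volume.restrict (cyl Ω T)).prod (volume.restrict (cellYZ N)) = 0 := by
    refine (integral_prod _ i2).trans (integral_eq_zero_of_ae ?_)
    filter_upwards [d.slice] with q hq
    rw [Pi.zero_apply, ← integral_form_corrector_eq_zero ha hχ (u0.grad q) ⟨_, _, hq⟩]
    refine integral_congr_ae (Eventually.of_forall fun p => ?_)
    have : u0.grad q + u1.grad (q, p) - d.grad (q, p)
        = u0.grad q - ∑ c : Fin N × Fin N, u0.grad q (c.2, c.1) • (χ c).grad p := by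
      simp only [hd, L2QPerVY.defect]
      abel
    simp only [this]
  calc ∫ z, form a z.2.1 (d.grad z) (d.grad z)
        ∂(volume.restrict (cyl Ω T)).prod (volume.restrict (cellYZ N))
      = ∫ z, (form a z.2.1 (u0.grad z.1 + u1.grad z) (d.grad z)
          - form a z.2.1 (u0.grad z.1 + u1.grad z - d.grad z) (d.grad z))
        ∂(volume.restrict (cyl Ω T)).prod (volume.restrict (cellYZ N)) := by
        refine integral_congr_ae (Eventually.of_forall fun z => ?_)
        simp only [← form_sub_left, ← hdg]
    _ = 0 := by
        rw [integral_sub i1 i2, hu.integral_form_eq_zero ha d, h2, sub_zero]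

theorem L2QPerVY.ae_eq_zero {d : L2QPerVY Ω T}
    (h : ∀ᵐ z ∂(volume.restrict (cyl Ω T)).prod (volume.restrict (cellYZ N)), d.grad z = 0) :
    ∀ᵐ z ∂(volume.restrict (cyl Ω T)).prod (volume.restrict (cellYZ N)), d.toFun z = 0 := by
  refine ae_prod_eq_zero_of_ae_ae (d.aesm.mono_measure
    (Measure.prod_mono le_rfl Measure.restrict_le_self)) ?_
  filter_upwards [d.slice, Measure.ae_ae_of_ae_prod h] with q h1 h2
  exact ae_restrict_of_ae (h1.ae_eq_zero h2)

end Cylinder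

end StokesHomogenization

theorem lemma3p2 {N : ℕ} (hN : 0 < N)
    (Ω : Set (Vec N)) (hΩ : IsOpen Ω) (hΩb : Bornology.IsBounded Ω) (T : ℝ) (hT : 0 < T)
    (a : Fin N → Fin N → Vec N → ℝ) (ha : IsAdmissible a)
    (f : ℝ → StrongDual ℝ (V Ω)) (hf : MemLp f 2 (volume.restrict (Ioo 0 T)))
    (u0 : L2V Ω T) (u1 : L2QPerVY Ω T) (hu : IsGlobalSolution a f u0 u1) :
    (∀ i k : Fin N, ∃ χ : L2PerVY N, IsCellSolution a i k χ ∧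
      ∀ χ' : L2PerVY N, IsCellSolution a i k χ' → χ'.toFun =ᵐ[volume] χ.toFun) ∧
    ∀ χ : Fin N → Fin N → L2PerVY N, (∀ i k, IsCellSolution a i k (χ i k)) →
      ∀ᵐ q ∂volume.restrict (cyl Ω T ×ˢ cellYZ N),
        u1.toFun q = - ∑ i, ∑ k, u0.grad q.1 (k, i) • (χ i k).toFun q.2 := by
  refine ⟨fun i k => ?_, fun χ hχ => ?_⟩
  · obtain ⟨χ, hχ⟩ := ha.exists_cellSolution i k
    exact ⟨χ, hχ, fun χ' hχ' => hχ.ae_eq ha hχ'⟩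
  · have h := L2QPerVY.ae_eq_zero
      (hu.grad_defect_ae_eq_zero ha (χ := fun c => χ c.1 c.2) fun c => hχ c.1 c.2)
    rw [restrict_cyl_prod_cellYZ]
    filter_upwards [h] with z hz
    rw [← Fintype.sum_prod_type' (f := fun i k => u0.grad z.1 (k, i) • (χ i k).toFun z.2)]
    exact eq_neg_of_add_eq_zero_left hz
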